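/- **Notation.** Let $\mathcal S$ be the category of finite ordinals $\underline n=\{1,\dots,n\}$ and arbitrary maps. For $\varphi:\underline m\to\underline n$ and $i\in\underline n$ let $\varepsilon_{\varphi,i}:\varphi^{-1}(i)\to\underline m$ be the unique monotone injection in $\mathcal S$ with image $\{j:\varphi(j)=i\}$, and for $\psi:\underline\ell\to\underline m$ let $\psi^\varphi_i:(\varphi\psi)^{-1}(i)\to\varphi^{-1}(i)$ be the unique map with $\varepsilon_{\varphi,i}\,\psi^\varphi_i=\psi\,\varepsilon_{\varphi\psi,i}$. An *operadic category* is a small category $\mathcal C$ with a chosen terminal object in each connected component (write $\tau_X:X\to uX$ for the unique map to the chosen terminal object of the component of $X$), a functor $|{-}|:\mathcal C\to\mathcal S$, and for all $X\in\mathcal C$ and $i\in|X|$ a functor $\mathcal C/X\to\mathcal C$, written $f\mapsto f^{-1}(i)$ on objects and $(g:fg\to f)\mapsto (g^f_i:(fg)^{-1}(i)\to f^{-1}(i))$ on morphisms, such that: $|uX|=\underline 1$; each $(1_X)^{-1}(i)$ is a chosen terminal object; $|f^{-1}(i)|=|f|^{-1}(i)$ and $|g^f_i|=|g|^{|f|}_i$;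 $\tau_X^{-1}(\ast)=X$ and $f^{\tau_X}_\ast=f$; and, for $j\in|f|^{-1}(i)$ and $\varepsilon=\varepsilon_{|f|,i}$, $(g^f_i)^{-1}(j)=g^{-1}(\varepsilon j)$ and $(h^{fg}_i)^{g^f_i}_j=h^g_{\varepsilon j}$. It is *unary* if $|X|=\underline 1$ for all $X$. An *operadic functor* is a functor that strictly preserves chosen terminal objects, cardinalities, fibres $f^{-1}(i)$ and fibre maps $g^f_i$. Let $\mathrm{OpCat}_1$ be the category of unary operadic categories and operadic functors. The (upper) *décalage* $D(C)$ of a simplicial set $C$ is the composite of $C$ with (the opposite of) the functor $T:\Delta\to\Delta$, $[n]\mapsto[n+1]$, that freely adjoins a top element. A simplicial set satisfies the *Segal condition* if for every $n$ each chain of $n$ composable edges is the spine of exactly one $n$-simplex. **Corollary.** The category $\mathrm{OpCat}_1$ is equivalent to the full subcategory of $[\Delta^{\mathrm{op}},\mathrm{Set}]$ on those simplicial sets $C$ for which $D(C)$ satisfies the Segal condition. The equivalence can be chosen so that, if $C$ is the simplicial set corresponding to a unary operadic category $\mathcal C$, then $D(C)\cong \mathrm N(\mathcal C)$, the nerve of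 the underlying category, naturally in $\mathcal C$. Moreover, this full subcategory of $[\Delta^{\mathrm{op}},\mathrm{Set}]$ is reflective. -/

import Mathlib

open CategoryTheory Opposite

universe v u

namespace Operadic

/-! ### The category of finite ordinals and arbitrary maps -/

/-- The objects of the category `𝒮` of finite ordinals and arbitrary maps: for every natural
number `n` one object, standing for an `n`-element ordinal (here `Fin n`). -/
structure FinOrdinal : Type where
  /-- the number of elements -/
  n : ℕ

instance : SmallCategory FinOrdinal where
  Hom a b := Fin a.n → Fin b.n
  id _ := id
  comp f g := g ∘ f

/-- The object `1` of `𝒮`. -/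
def FinOrdinal.one : FinOrdinal := ⟨1⟩

namespace FinOrdinal

/-- The set of elements of `m` that `φ : m ⟶ n` sends to `i`. -/
def fibreSet {m n : FinOrdinal} (φ : m ⟶ n) (i : Fin n.n) : Finset (Fin m.n) :=
  Finset.univ.filter fun j => φ j = i

/-- The fibre `φ⁻¹(i)`, as an object of `𝒮`. -/
def fibre {m n : FinOrdinal} (φ : m ⟶ n) (i : Fin n.n) : FinOrdinal :=
  ⟨(fibreSet φ i).card⟩

/-- The unique monotone injection `ε : φ⁻¹(i) → m` with image `{j | φ j = i}`. -/
def fibreIncl {m n : FinOrdinal} (φ : m ⟶ n) (i : Fin n.n) : Fin (fibre φ i).n ↪o Fin m.n :=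
  (fibreSet φ i).orderEmbOfFin rfl

/-- The fibre map `(φψ)⁻¹(i) → φ⁻¹(i)` of `ψ` with respect to `φ` at `i`: the restriction of `ψ`
along the injections `ε` (see `fibreIncl_fibreMap`). -/
def fibreMap {l m n : FinOrdinal} (ψ : l ⟶ m) (φ : m ⟶ n) (i : Fin n.n) :
    fibre (ψ ≫ φ) i ⟶ fibre φ i := fun j =>
  ((fibreSet φ i).orderIsoOfFin rfl).symm
    ⟨ψ (fibreIncl (ψ ≫ φ) i j), by
      have h := (fibreSet (ψ ≫ φ) i).orderEmbOfFin_mem rfl j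
      exact Finset.mem_filter.2 ⟨Finset.mem_univ _, (Finset.mem_filter.1 h).2⟩⟩

theorem fibreIncl_fibreMap {l m n : FinOrdinal} (ψ : l ⟶ m) (φ : m ⟶ n) (i : Fin n.n)
    (j : Fin (fibre (ψ ≫ φ) i).n) :
    fibreIncl φ i (fibreMap ψ φ i j) = ψ (fibreIncl (ψ ≫ φ) i j) := by
  exact congrArg Subtype.val (((fibreSet φ i).orderIsoOfFin rfl).apply_symm_apply
    ⟨ψ (fibreIncl (ψ ≫ φ) i j), _⟩)

end FinOrdinal

/-! ### Operadic categories -/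

/-- A category endowed with local terminal objects: each connected component has a chosen
terminal object. -/
structure LocalTerminals (C : Type u) [Category.{v} C] where
  /-- the chosen object of a connected component -/
  term : CategoryTheory.ConnectedComponents C → C
  term_mem : ∀ c, CategoryTheory.ConnectedComponents.mk (term c) = c
  /-- the map `τ_X` from `X` to the chosen object `uX` of its component -/
  τ : ∀ X : C, X ⟶ term (CategoryTheory.ConnectedComponents.mk X)
  τ_uniq : ∀ (X : C) (f : X ⟶ term (CategoryTheory.ConnectedComponents.mk X)), f = τ X

/-- The chosen terminal object `uX` in the connected component of `X`. -/
abbrev LocalTerminals.u {C : Type u} [Category.{v} C] (t : LocalTerminals C) (X : C) : C :=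
  t.term (CategoryTheory.ConnectedComponents.mk X)

/-- The data of an operadic category, without the axioms. -/
structure OperadicData (C : Type u) [Category.{v} C] extends LocalTerminals C where
  /-- the cardinality functor `|-|` -/
  card : C ⥤ FinOrdinal
  /-- the fibre functors `C / X ⥤ C`, for `i ∈ |X|` -/
  fibreFunctor : ∀ (X : C), Fin (card.obj X).n → (Over X ⥤ C)

namespace OperadicData

variable {C : Type u} [Category.{v} C] (S : OperadicData C)

/-- The fibre `f⁻¹(i)`. -/
def fibre {Y X : C} (f : Y ⟶ X) (i : Fin (S.card.obj X).n) : C :=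
  (S.fibreFunctor X i).obj (Over.mk f)

/-- The fibre map `(fg)⁻¹(i) ⟶ f⁻¹(i)` of `g` with respect to `f` at `i`. -/
def fibreMap {Z Y X : C} (g : Z ⟶ Y) (f : Y ⟶ X) (i : Fin (S.card.obj X).n) :
    S.fibre (g ≫ f) i ⟶ S.fibre f i :=
  (S.fibreFunctor X i).map (Over.homMk g : Over.mk (g ≫ f) ⟶ Over.mk f)

end OperadicData

/-- The axioms of an operadic category. Equalities of morphisms whose domains and codomains are
only propositionally equal are written with heterogeneous equality. -/
structure OperadicData.IsOperadic {C : Type u} [Category.{v} C] (S : OperadicData C) : Prop where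
  /-- local terminals have cardinality `1` -/
  card_term : ∀ c, S.card.obj (S.term c) = FinOrdinal.one
  /-- fibres of identities are chosen terminals -/
  fibre_id : ∀ (X : C) (i : Fin (S.card.obj X).n), ∃ c, S.fibre (𝟙 X) i = S.term c
  /-- `|f⁻¹(i)| = |f|⁻¹(i)` -/
  card_fibre : ∀ {Y X : C} (f : Y ⟶ X) (i : Fin (S.card.obj X).n),
    S.card.obj (S.fibre f i) = FinOrdinal.fibre (S.card.map f) i
  /-- the cardinality of a fibre map is the fibre map of the cardinalities -/
  card_fibreMap : ∀ {Z Y X : C} (g : Z ⟶ Y) (f : Y ⟶ X) (i : Fin (S.card.obj X).n),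
    S.card.map (S.fibreMap g f i) ≍ FinOrdinal.fibreMap (S.card.map g) (S.card.map f) i
  /-- `τ_X⁻¹(*) = X`, where `*` is the only element of `|uX| = 1` -/
  fibre_τ : ∀ (X : C) (i : Fin (S.card.obj (S.u X)).n), S.fibre (S.τ X) i = X
  /-- the fibre map of `f : Y ⟶ X` with respect to `τ_X` at `*` is `f` -/
  fibreMap_τ : ∀ {Y X : C} (f : Y ⟶ X) (i : Fin (S.card.obj (S.u X)).n),
    S.fibreMap f (S.τ X) i ≍ f
  /-- the fibres of the fibre maps of `f` are fibres: for `j ∈ |f|⁻¹(i) = |f⁻¹(i)|`, the fibre at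
  `j` of the fibre map of `g` with respect to `f` at `i` is `g⁻¹(εj)` -/
  fibre_fibreMap : ∀ {Z Y X : C} (g : Z ⟶ Y) (f : Y ⟶ X) (i : Fin (S.card.obj X).n)
    (j : Fin (FinOrdinal.fibre (S.card.map f) i).n),
    S.fibre (S.fibreMap g f i) (Fin.cast (congrArg FinOrdinal.n (card_fibre f i).symm) j) =
      S.fibre g (FinOrdinal.fibreIncl (S.card.map f) i j)
  /-- the fibre maps of the fibre maps of `f` are fibre maps -/
  fibreMap_fibreMap : ∀ {W Z Y X : C} (h : W ⟶ Z) (g : Z ⟶ Y) (f : Y ⟶ X)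
    (i : Fin (S.card.obj X).n) (j : Fin (FinOrdinal.fibre (S.card.map f) i).n),
    S.fibreMap (S.fibreMap h (g ≫ f) i) (S.fibreMap g f i)
        (Fin.cast (congrArg FinOrdinal.n (card_fibre f i).symm) j) ≍
      S.fibreMap h g (FinOrdinal.fibreIncl (S.card.map f) i j)

/-- A small operadic category. -/
structure OpCat : Type (u + 1) where
  /-- the set of objects -/
  carrier : Type u
  [cat : SmallCategory carrier]
  /-- the local terminals, the cardinality functor and the fibre functors -/
  str : OperadicData carrier
  isOperadic : str.IsOperadic

namespace OpCat

instance (A : OpCat.{u}) : SmallCategory A.carrier := A.cat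

/-- `F` is an operadic functor: it strictly preserves local terminal objects, strictly commutes
with the cardinality functors, and preserves fibres and fibre maps. -/
structure IsOperadicFunctor {A B : OpCat.{u}} (F : A.carrier ⥤ B.carrier) : Prop where
  map_u : ∀ X, F.obj (A.str.u X) = B.str.u (F.obj X)
  comp_card : F ⋙ B.str.card = A.str.card
  map_fibre : ∀ {Y X : A.carrier} (f : Y ⟶ X) (i : Fin (A.str.card.obj X).n),
    F.obj (A.str.fibre f i) = B.str.fibre (F.map f)
      (Fin.cast (congrArg (fun G : A.carrier ⥤ FinOrdinal => (G.obj X).n) comp_card.symm) i)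
  map_fibreMap : ∀ {Z Y X : A.carrier} (g : Z ⟶ Y) (f : Y ⟶ X) (i : Fin (A.str.card.obj X).n),
    F.map (A.str.fibreMap g f i) ≍ B.str.fibreMap (F.map g) (F.map f)
      (Fin.cast (congrArg (fun G : A.carrier ⥤ FinOrdinal => (G.obj X).n) comp_card.symm) i)

theorem IsOperadicFunctor.id (A : OpCat.{u}) : IsOperadicFunctor (A := A) (B := A) (𝟭 _) where
  map_u _ := rfl
  comp_card := rfl
  map_fibre _ _ := rfl
  map_fibreMap _ _ _ := HEq.rfl

theorem map_heq {C D : Type*} [Category* C] [Category* D] (G : C ⥤ D)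
    {X X' Y Y' : C} {f : X ⟶ Y} {f' : X' ⟶ Y'} (hX : X = X') (hY : Y = Y') (h : f ≍ f') :
    G.map f ≍ G.map f' := by
  subst hX hY
  cases h
  rfl

theorem IsOperadicFunctor.comp {A B D : OpCat.{u}} {F : A.carrier ⥤ B.carrier}
    {G : B.carrier ⥤ D.carrier} (hF : IsOperadicFunctor F) (hG : IsOperadicFunctor G) :
    IsOperadicFunctor (F ⋙ G) where
  map_u X := (congrArg G.obj (hF.map_u X)).trans (hG.map_u _)
  comp_card := by rw [Functor.assoc, hG.comp_card, hF.comp_card]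
  map_fibre f i := (congrArg G.obj (hF.map_fibre f i)).trans (hG.map_fibre _ _)
  map_fibreMap g f i := by
    refine HEq.trans (map_heq G ?_ (hF.map_fibre f i) (hF.map_fibreMap g f i))
      (hG.map_fibreMap _ _ _)
    rw [← F.map_comp]
    exact hF.map_fibre (g ≫ f) i

/-- Operadic functors. -/
@[ext]
structure Hom (A B : OpCat.{u}) where
  /-- the underlying functor -/
  functor : A.carrier ⥤ B.carrier
  isOperadicFunctor : IsOperadicFunctor functor

/-- The category of small operadic categories and operadic functors. -/
instance : Category OpCat.{u} where
  Hom := Hom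
  id A := ⟨𝟭 _, .id A⟩
  comp f g := ⟨f.functor ⋙ g.functor, f.isOperadicFunctor.comp g.isOperadicFunctor⟩

/-- The underlying category of an operadic category. -/
def forget : OpCat.{u} ⥤ Cat.{u, u} where
  obj A := Cat.of A.carrier
  map f := f.functor.toCatHom

/-- An operadic category is unary if every object has cardinality `1`. -/
def isUnary : ObjectProperty OpCat.{u} := fun A => ∀ X, A.str.card.obj X = FinOrdinal.one

end OpCat

/-- The category of small unary operadic categories and operadic functors. -/
abbrev UnaryOpCat : Type (u + 1) := OpCat.isUnary.{u}.FullSubcategory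

/-! ### Décalage -/

/-- The map `n + 1 → m + 1` obtained from a monotone map `f : n → m` of finite ordinals by adding
a top element to both sides. -/
def addTopHom {n m : ℕ} (f : Fin n →o Fin m) : Fin (n + 1) →o Fin (m + 1) where
  toFun := Fin.lastCases (Fin.last m) fun i => (f i).castSucc
  monotone' := by
    intro i j hij
    induction j using Fin.lastCases with
    | last => simpa using Fin.le_last _
    | cast j =>
      induction i using Fin.lastCases with
      | last => exact absurd hij (not_le.2 (Fin.castSucc_lt_last j))
      | cast i => simpa using f.monotone (Fin.castSucc_le_castSucc_iff.1 hij)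

theorem addTopHom_last {n m : ℕ} (f : Fin n →o Fin m) :
    addTopHom f (Fin.last n) = Fin.last m :=
  Fin.lastCases_last (motive := fun _ => Fin (m + 1))

theorem addTopHom_castSucc {n m : ℕ} (f : Fin n →o Fin m) (i : Fin n) :
    addTopHom f i.castSucc = (f i).castSucc :=
  Fin.lastCases_castSucc (motive := fun _ => Fin (m + 1)) i

theorem addTopHom_comp {l n m : ℕ} (g : Fin n →o Fin m) (f : Fin l →o Fin n) :
    addTopHom (g.comp f) = (addTopHom g).comp (addTopHom f) := by
  ext i : 2
  induction i using Fin.lastCases <;>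
    simp only [OrderHom.comp_coe, Function.comp_apply, addTopHom_last, addTopHom_castSucc]

/-- The functor `T : Δ ⥤ Δ`, `[n] ↦ [n + 1]`, that freely adjoins a top element. -/
def addTop : SimplexCategory ⥤ SimplexCategory where
  obj a := SimplexCategory.mk (a.len + 1)
  map f := SimplexCategory.Hom.mk (addTopHom f.toOrderHom)
  map_id a := by
    ext i : 3
    induction i using Fin.lastCases <;> simp [addTopHom]
  map_comp f g := by
    rw [SimplexCategory.comp_toOrderHom, addTopHom_comp]
    rfl

/-- The (upper) décalage `D` of simplicial sets: precomposition with `T`. -/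
def dec : SSet.{u} ⥤ SSet.{u} :=
  (Functor.whiskeringLeft _ _ (Type u)).obj addTop.op

/-- The simplicial sets `C` for which `D(C)` satisfies the Segal condition. -/
def isDecSegal : ObjectProperty SSet.{u} := fun C => (dec.obj C).IsStrictSegal

end Operadic

namespace Operadic

/-! Idea of the proof. When all cardinalities are `1`, an operadic category amounts to a category
with a class of local terminal objects and fibre functors C/X → C satisfying the fibre axioms
(`UnaryStructure`). The simplicial set assigned to it (`operadicNerve`) consists of the chains x₀ →
… → xₙ with xₙ local terminal. An operator a restricts a chain along a and takes fibres over
x_{a(top)}. If a preserves the top element, these are fibres over a local terminal, so nothing but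
restriction happens; the top face is where genuine fibres enter. The end of a chain is forced by the
objects before it, so forgetting it identifies the décalage with the ordinary nerve
(`decOperadicNerve`).

Conversely, if D(K) is Segal, then D(K) ≅ N(C) for the category C of its edges (`Segal.nerveIso`).
What K has beyond D(K) is its vertices, its top degeneracies and its top faces. Degenerate
1-simplices of K are the local terminals, and top degeneracies supply the unique maps to them
(`DecNerve.mk₁_eq_of_isTerm`). Top faces, applied to chains ending in X, form a map N(C/X) → N(C),
which is a functor `DecNerve.fib` because the nerve is full. The simplicial identities become the
axioms, and K is recovered as the nerve of this structure (`DecNerve.toOperadicNerve`).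

For full faithfulness, a simplicial map gives a functor through its décalage, and this functor
determines the map because each simplex can be read off from its top degeneracy
(`exists_eq_operadicNerveMap`).

Reflectivity holds because the condition on D(K) is orthogonality to a small family of maps between
finitely presentable simplicial sets (`isDecSegal_eq_isLocal`). -/

/-! ### Unary structures and their nerve -/

/-- The structure of a unary operadic category on a category `C`: a predicate singling out the
local terminal objects, and a fibre functor `C / X ⥤ C` for each object `X`. -/
@[ext]
structure UnaryStructure (C : Type u) [Category.{v} C] where
  IsTerm : C → Prop
  fib : ∀ X : C, Over X ⥤ C
  exists_term : ∀ X, ∃ T, IsTerm T ∧ Nonempty (X ⟶ T)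
  term_uniq : ∀ {X T T' : C}, IsTerm T → IsTerm T' → (X ⟶ T) → (X ⟶ T') → T = T'
  hom_uniq : ∀ {X T : C}, IsTerm T → ∀ f g : X ⟶ T, f = g
  isTerm_fib_id : ∀ X, IsTerm ((fib X).obj (Over.mk (𝟙 X)))
  fib_obj_term : ∀ {T : C}, IsTerm T → ∀ A : Over T, (fib T).obj A = A.left
  fib_map_term : ∀ {T : C}, IsTerm T → ∀ {A B : Over T} (u : A ⟶ B), (fib T).map u ≍ u.left
  fib_obj_fib_map : ∀ {X : C} {A B : Over X} (u : A ⟶ B),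
    (fib ((fib X).obj B)).obj (Over.mk ((fib X).map u)) = (fib B.left).obj (Over.mk u.left)
  fib_map_fib_map : ∀ {X : C} {A B D : Over X} (w : A ⟶ B) (u : B ⟶ D),
    (fib ((fib X).obj D)).map
        (Over.homMk ((fib X).map w) :
          Over.mk ((fib X).map w ≫ (fib X).map u) ⟶ Over.mk ((fib X).map u)) ≍
      (fib D.left).map (Over.homMk w.left : Over.mk (w.left ≫ u.left) ⟶ Over.mk u.left)

theorem map_homMk_heq {C : Type u} [Category.{v} C] {X Y Z : C} (F : Over X ⥤ C) {a a' : Z ⟶ X}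
    (h : a = a') {b : Y ⟶ X} {k : Z ⟶ Y} (hk : k ≫ b = a) (hk' : k ≫ b = a') :
    F.map (Over.homMk k hk : Over.mk a ⟶ Over.mk b) ≍
      F.map (Over.homMk k hk' : Over.mk a' ⟶ Over.mk b) := by
  subst h
  rfl

/-- The restriction of a chain `F` along `a`, as a chain of objects over the object at `b`. -/
@[simps]
def overRestrict {C : Type u} [Category.{v} C] {m n : ℕ} (F : Fin n ⥤ C) (a : Fin m →o Fin n)
    (b : Fin n) (h : ∀ i, a i ≤ b) : Fin m ⥤ Over (F.obj b) where
  obj i := Over.mk (F.map (homOfLE (h i)))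
  map {i j} f := Over.homMk (F.map (homOfLE (a.monotone (leOfHom f)))) (by
    simp [← F.map_comp])
  map_id i := by ext; exact F.map_id _
  map_comp f g := by ext; simp [← F.map_comp]

namespace UnaryStructure

variable {C : Type u} [Category.{v} C] (S : UnaryStructure C)

theorem uniq {X T T' : C} (hT : S.IsTerm T) (hT' : S.IsTerm T') (f : X ⟶ T) (g : X ⟶ T') :
    T = T' ∧ f ≍ g := by
  obtain rfl := S.term_uniq hT hT' f g
  exact ⟨rfl, heq_of_eq (S.hom_uniq hT f g)⟩

theorem fib_map_fib_map_of_eq {X : C} {A B D : Over X} (w : A ⟶ B) (u : B ⟶ D) (t : A ⟶ D)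
    (h : w ≫ u = t) :
    (S.fib ((S.fib X).obj D)).map
        (Over.homMk ((S.fib X).map w) (by simp [← h]) :
          Over.mk ((S.fib X).map t) ⟶ Over.mk ((S.fib X).map u)) ≍
      (S.fib D.left).map (Over.homMk w.left (by simp [← h]) : Over.mk t.left ⟶ Over.mk u.left) := by
  subst h
  exact ((map_homMk_heq _ ((S.fib X).map_comp w u) _ _).trans (S.fib_map_fib_map w u)).trans
    (map_homMk_heq _ (rfl : w.left ≫ u.left = (w ≫ u).left) _ _)

/-- The chain of fibres over the object at `b` of the restriction along `a` of a chain. -/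
def pull {m n : ℕ} (F : Fin n ⥤ C) (a : Fin m →o Fin n)
    (b : Fin n) (h : ∀ i, a i ≤ b) : Fin m ⥤ C :=
  overRestrict F a b h ⋙ S.fib (F.obj b)

/-- Fibres over a local terminal are trivial. Hence operators that preserve the top element act on
the nerve by mere restriction. -/
theorem pull_term {m n : ℕ} (F : Fin n ⥤ C) (a : Fin m →o Fin n)
    (b : Fin n) (h : ∀ i, a i ≤ b) (hb : S.IsTerm (F.obj b)) :
    S.pull F a b h = a.monotone.functor ⋙ F :=
  Functor.hext (fun _ => S.fib_obj_term hb _) (fun _ _ _ => S.fib_map_term hb _)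

/-- Fibres of fibre maps are fibres: the two iteration axioms are exactly the functoriality of the
nerve. -/
theorem pull_pull {k m n : ℕ} (F : Fin n ⥤ C) (a : Fin m →o Fin n)
    (b : Fin n) (h : ∀ i, a i ≤ b) (a' : Fin k →o Fin m) (b' : Fin m) (h' : ∀ i, a' i ≤ b') :
    S.pull (S.pull F a b h) a' b' h' =
      S.pull F (a.comp a') (a b') (fun i => a.monotone (h' i)) := by
  refine Functor.hext (fun i => S.fib_obj_fib_map _) (fun i j f => ?_)
  exact S.fib_map_fib_map_of_eq ((overRestrict F a b h).map (homOfLE (a'.monotone (leOfHom f))))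
    ((overRestrict F a b h).map (homOfLE (h' j))) ((overRestrict F a b h).map (homOfLE (h' i)))
    (by rw [← Functor.map_comp]; rfl)

theorem pull_congr {m n : ℕ} (F : Fin n ⥤ C) {a a' : Fin m →o Fin n} (ha : a = a')
    {b b' : Fin n} (hb : b = b') (h : ∀ i, a i ≤ b) (h' : ∀ i, a' i ≤ b') :
    S.pull F a b h = S.pull F a' b' h' := by
  subst ha hb
  rfl

/-- The entry at `i` is the fibre of an identity, so operators preserve the condition on the end of
a chain. -/
theorem isTerm_pull {m n : ℕ} (F : Fin n ⥤ C) (a : Fin m →o Fin n) (i : Fin m)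
    (h : ∀ j, a j ≤ a i) : S.IsTerm ((S.pull F a (a i) h).obj i) := by
  have := S.isTerm_fib_id (F.obj (a i))
  rw [← F.map_id] at this
  exact this

end UnaryStructure

/-- The nerve of a unary operadic category: its `n`-simplices are the chains of `n` morphisms
that end in a local terminal object. -/
def operadicNerve {C : Type u} [SmallCategory C] (S : UnaryStructure C) : SSet.{u} where
  obj Δ := { F : ComposableArrows C Δ.unop.len // S.IsTerm (F.obj (Fin.last _)) }
  map f := ↾fun F => ⟨S.pull F.1 f.unop.toOrderHom (f.unop.toOrderHom (Fin.last _))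
    (fun i => f.unop.toOrderHom.monotone (Fin.le_last i)), S.isTerm_pull _ _ _ _⟩
  map_id Δ := by
    refine ConcreteCategory.hom_ext _ _ fun F => Subtype.ext ?_
    exact S.pull_term _ _ _ _ F.2
  map_comp f g := by
    refine ConcreteCategory.hom_ext _ _ fun F => Subtype.ext ?_
    exact (S.pull_pull F.1 f.unop.toOrderHom _ _ g.unop.toOrderHom
      (g.unop.toOrderHom (Fin.last _)) _).symm


/-! ### Chains with a prescribed last object -/

/-- The inclusion of `Fin n` into `Fin (n + 1)` as an initial segment. -/
abbrev castSuccHom (n : ℕ) : Fin n →o Fin (n + 1) :=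
  Fin.castSuccOrderEmb.toOrderHom

theorem addTopHom_comp_castSuccHom {m n : ℕ} (a : Fin m →o Fin n) :
    (addTopHom a).comp (castSuccHom m) = (castSuccHom n).comp a := by
  ext i : 2
  exact addTopHom_castSucc a i

section Snoc

variable {C : Type u} [Category.{v} C]

theorem map_homOfLE_heq {P : Type*} [Preorder P] (F : P ⥤ C) {a a' b b' : P} (ha : a = a')
    (hb : b = b') (h : a ≤ b) (h' : a' ≤ b') : F.map (homOfLE h) ≍ F.map (homOfLE h') := by
  subst ha hb
  rfl

instance {P : Type*} [Preorder P] : Quiver.IsThin (WithTerminal P) := fun a b =>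
  match a, b with
  | .of a, .of b => inferInstanceAs (Subsingleton (a ⟶ b))
  | .of _, .star => inferInstanceAs (Subsingleton PUnit)
  | .star, .star => inferInstanceAs (Subsingleton PUnit)
  | .star, .of _ => inferInstanceAs (Subsingleton PEmpty)

theorem thin_hom_heq {P : Type*} [Category* P] [Quiver.IsThin P] {a a' b b' : P} (ha : a = a')
    (hb : b = b') (f : a ⟶ b) (g : a' ⟶ b') : f ≍ g := by
  subst ha hb
  exact heq_of_eq (Subsingleton.elim _ _)

/-- The ordinal `n + 1` as the ordinal `n` with a terminal object added. -/
noncomputable def finToWithTerminal (n : ℕ) : Fin (n + 1) ⥤ WithTerminal (Fin n) where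
  obj := Fin.lastCases .star .of
  -- The target is thin, so the laws do not depend on the morphism chosen.
  map {i j} f := Classical.choice (by
    have h := leOfHom f
    clear f
    induction j using Fin.lastCases with
    | last =>
      rw [Fin.lastCases_last]
      exact ⟨WithTerminal.starTerminal.from _⟩
    | cast j =>
      induction i using Fin.lastCases with
      | last => exact absurd h (not_le.2 (Fin.castSucc_lt_last j))
      | cast i =>
        rw [Fin.lastCases_castSucc, Fin.lastCases_castSucc]
        exact ⟨WithTerminal.incl.map (homOfLE (Fin.castSucc_le_castSucc_iff.1 h))⟩)
  map_id _ := Subsingleton.elim _ _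
  map_comp _ _ := Subsingleton.elim _ _

theorem finToWithTerminal_last (n : ℕ) : (finToWithTerminal n).obj (Fin.last n) = .star :=
  Fin.lastCases_last (motive := fun _ => WithTerminal (Fin n))

theorem finToWithTerminal_castSucc {n : ℕ} (i : Fin n) :
    (finToWithTerminal n).obj i.castSucc = .of i :=
  Fin.lastCases_castSucc (motive := fun _ => WithTerminal (Fin n)) i

theorem castSucc_comp_finToWithTerminal (n : ℕ) :
    (castSuccHom n).monotone.functor ⋙ finToWithTerminal n = WithTerminal.incl :=
  Functor.hext finToWithTerminal_castSucc fun i j _ =>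
    thin_hom_heq (finToWithTerminal_castSucc i) (finToWithTerminal_castSucc j) _ _

/-- A chain of objects over `X`, extended by `X`. -/
noncomputable def snoc {n : ℕ} {X : C} (H : Fin n ⥤ Over X) : Fin (n + 1) ⥤ C :=
  finToWithTerminal n ⋙ WithTerminal.lift (Z := X) (H ⋙ Over.forget X) (fun i => (H.obj i).hom)
    (fun _ _ f => Over.w (H.map f))

variable {n : ℕ}

theorem castSucc_comp_snoc {X : C} (H : Fin n ⥤ Over X) :
    (castSuccHom n).monotone.functor ⋙ snoc H = H ⋙ Over.forget X := by
  rw [snoc, ← Functor.assoc, castSucc_comp_finToWithTerminal]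
  rfl

theorem snoc_last {X : C} (H : Fin n ⥤ Over X) : (snoc H).obj (Fin.last n) = X := by
  rw [snoc, Functor.comp_obj, finToWithTerminal_last]
  rfl

theorem snoc_map_last {X : C} (H : Fin n ⥤ Over X) (i : Fin n) :
    (snoc H).map (homOfLE (Fin.le_last i.castSucc)) ≍ (H.obj i).hom :=
  OpCat.map_heq (WithTerminal.lift (Z := X) (H ⋙ Over.forget X) (fun i => (H.obj i).hom)
    (fun _ _ f => Over.w (H.map f))) (finToWithTerminal_castSucc i) (finToWithTerminal_last n)
    (thin_hom_heq (finToWithTerminal_castSucc i) (finToWithTerminal_last n) _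
      (WithTerminal.homFrom i))

/-- Every morphism of the ordinal lies in the initial segment or ends at the top element, so these
data determine a chain. -/
theorem snoc_ext {F G : Fin (n + 1) ⥤ C}
    (h : (castSuccHom n).monotone.functor ⋙ F = (castSuccHom n).monotone.functor ⋙ G)
    (hl : F.obj (Fin.last n) = G.obj (Fin.last n))
    (hm : ∀ i : Fin n, F.map (homOfLE (Fin.le_last i.castSucc)) ≍
      G.map (homOfLE (Fin.le_last i.castSucc))) : F = G := by
  have ho : ∀ i, F.obj i = G.obj i := fun i => by
    induction i using Fin.lastCases with
    | last => exact hl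
    | cast i => exact Functor.congr_obj h i
  suffices hm' : ∀ i j (hij : i ≤ j), F.map (homOfLE hij) ≍ G.map (homOfLE hij) from
    Functor.hext ho fun i j f => hm' i j (leOfHom f)
  intro i j hij
  induction j using Fin.lastCases with
  | last =>
    induction i using Fin.lastCases with
    | last =>
      change F.map (𝟙 _) ≍ G.map (𝟙 _)
      rw [F.map_id, G.map_id, hl]
    | cast i => exact hm i
  | cast j =>
    induction i using Fin.lastCases with
    | last => exact absurd hij (not_le.2 (Fin.castSucc_lt_last j))
    | cast i => exact Functor.hcongr_hom h (homOfLE (Fin.castSucc_le_castSucc_iff.1 hij))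

/-- The chain of the first objects of a chain, over its last object. -/
abbrev overLast (F : Fin (n + 1) ⥤ C) : Fin n ⥤ Over (F.obj (Fin.last n)) :=
  overRestrict F (castSuccHom n) (Fin.last n) (fun _ => Fin.le_last _)

theorem snoc_overLast (F : Fin (n + 1) ⥤ C) : snoc (overLast F) = F :=
  snoc_ext (castSucc_comp_snoc _) (snoc_last _) (snoc_map_last _)

/-- Extending by the base object turns an operator a into T(a); this gives the naturality of
`DecNerve.fibNerve`. -/
theorem snoc_comp {m : ℕ} {X : C} (H : Fin n ⥤ Over X) (a : Fin m →o Fin n) :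
    snoc (a.monotone.functor ⋙ H) = (addTopHom a).monotone.functor ⋙ snoc H := by
  have hl := addTopHom_last a
  refine snoc_ext ?_ ?_ fun i => ?_
  · have := congrArg (fun b : Fin m →o Fin (n + 1) => b.monotone.functor ⋙ snoc H)
      (addTopHom_comp_castSuccHom a)
    refine (castSucc_comp_snoc _).trans (Eq.trans ?_ this.symm)
    exact congrArg (a.monotone.functor ⋙ ·) (castSucc_comp_snoc H).symm
  · refine (snoc_last _).trans ((snoc_last H).symm.trans ?_)
    exact congrArg (snoc H).obj hl.symm
  · refine (snoc_map_last _ i).trans ((snoc_map_last H (a i)).symm.trans ?_)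
    exact map_homOfLE_heq _ (addTopHom_castSucc a i).symm hl.symm _ _

end Snoc


/-! ### The functoriality and the décalage of the nerve of a unary operadic category -/

section

variable {C : Type u} [SmallCategory C] {D : Type u} [SmallCategory D]

/-- A functor preserves the structures of unary operadic categories. -/
structure UnaryStructure.IsMap (S : UnaryStructure C) (T : UnaryStructure D) (F : C ⥤ D) :
    Prop where
  isTerm : ∀ {X}, S.IsTerm X → T.IsTerm (F.obj X)
  fib_comp : ∀ X, S.fib X ⋙ F = Over.post F ⋙ T.fib (F.obj X)

variable {S : UnaryStructure C} {T : UnaryStructure D} {F : C ⥤ D}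

theorem UnaryStructure.IsMap.pull_comp (hF : S.IsMap T F) {m n : ℕ} (G : Fin n ⥤ C)
    (a : Fin m →o Fin n) (b : Fin n) (h : ∀ i, a i ≤ b) :
    S.pull G a b h ⋙ F = T.pull (G ⋙ F) a b h :=
  congrArg (overRestrict G a b h ⋙ ·) (hF.fib_comp (G.obj b))

/-- The map of nerves induced by a functor that preserves the structures. -/
def operadicNerveMap (hF : S.IsMap T F) : operadicNerve S ⟶ operadicNerve T where
  app Δ := ↾fun x => ⟨x.1 ⋙ F, hF.isTerm x.2⟩
  naturality _ _ f := by
    refine ConcreteCategory.hom_ext _ _ fun x => Subtype.ext ?_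
    exact hF.pull_comp x.1 f.unop.toOrderHom _ _

variable (S)

/-- The map from the décalage of the nerve of a unary operadic category to the nerve of its
underlying category that forgets the last object of a chain. -/
def decOperadicNerve : dec.obj (operadicNerve S) ⟶ nerve C where
  app Δ := ↾fun x => (castSuccHom (Δ.unop.len + 1)).monotone.functor ⋙ x.1
  naturality X Y f := by
    refine ConcreteCategory.hom_ext _ _ fun x => ?_
    have hl := addTopHom_last f.unop.toOrderHom
    have ht : S.IsTerm (x.1.obj (addTopHom f.unop.toOrderHom (Fin.last _))) :=
      hl.symm ▸ x.2
    refine Eq.trans (congrArg ((castSuccHom (Y.unop.len + 1)).monotone.functor ⋙ ·)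
      (S.pull_term x.1 (addTopHom f.unop.toOrderHom) _ _ ht)) ?_
    exact congrArg (fun b : Fin (Y.unop.len + 1) →o Fin _ => b.monotone.functor ⋙ x.1)
      (addTopHom_comp_castSuccHom f.unop.toOrderHom)

theorem decOperadicNerve_naturality (hF : S.IsMap T F) :
    dec.map (operadicNerveMap hF) ≫ decOperadicNerve T = decOperadicNerve S ≫ nerveMap F :=
  rfl

/-- The end of the chain and all maps into it are forced by the uniqueness in `hP`; one earlier
object is needed, whence `n + 2`. The predicate is abstract so that the lemma also serves degenerate
edges of a simplicial set, before these are known to form a unary structure. -/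
theorem chain_ext {P : C → Prop}
    (hP : ∀ {X T T' : C}, P T → P T' → ∀ (f : X ⟶ T) (g : X ⟶ T'), T = T' ∧ f ≍ g)
    {n : ℕ} {F G : Fin (n + 2) ⥤ C}
    (h : (castSuccHom (n + 1)).monotone.functor ⋙ F = (castSuccHom (n + 1)).monotone.functor ⋙ G)
    (hF : P (F.obj (Fin.last _))) (hG : P (G.obj (Fin.last _))) : F = G := by
  have ho (i : Fin (n + 1)) : F.obj i.castSucc = G.obj i.castSucc := Functor.congr_obj h i
  have hm {X X' T T' : C} (hX : X = X') (hT : P T) (hT' : P T') (f : X ⟶ T) (g : X' ⟶ T') :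
      T = T' ∧ f ≍ g := by
    subst hX
    exact hP hT hT' f g
  exact snoc_ext h (hm (ho 0) hF hG (F.map (homOfLE (Fin.le_last _)))
    (G.map (homOfLE (Fin.le_last _)))).1 fun i => (hm (ho i) hF hG _ _).2

theorem UnaryStructure.exists_chain {n : ℕ} (G : Fin (n + 1) ⥤ C) :
    ∃ F : Fin (n + 2) ⥤ C, S.IsTerm (F.obj (Fin.last _)) ∧
      (castSuccHom (n + 1)).monotone.functor ⋙ F = G := by
  obtain ⟨T, hT, ⟨f⟩⟩ := S.exists_term (G.obj (Fin.last n))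
  let H : Fin (n + 1) ⥤ Over T :=
    { obj i := Over.mk (G.map (homOfLE (Fin.le_last i)) ≫ f)
      map g := Over.homMk (G.map g) (S.hom_uniq hT _ _)
      map_id i := by ext; exact G.map_id i
      map_comp g g' := by ext; exact G.map_comp g g' }
  exact ⟨snoc H, (snoc_last H).symm ▸ hT, castSucc_comp_snoc H⟩

instance : IsIso (decOperadicNerve S) := by
  rw [NatTrans.isIso_iff_isIso_app]
  intro Δ
  rw [isIso_iff_bijective]
  refine ⟨fun x y h => Subtype.ext (chain_ext S.uniq h x.2 y.2), fun G => ?_⟩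
  obtain ⟨F, hF, h⟩ := S.exists_chain G
  exact ⟨⟨F, hF⟩, h⟩

/-- The décalage of the nerve of a unary operadic category is the nerve of its underlying
category. -/
noncomputable def decOperadicNerveIso : dec.obj (operadicNerve S) ≅ nerve C :=
  asIso (decOperadicNerve S)

/-- The top degeneracy of a simplicial set. -/
def topDegen (K : SSet.{u}) (n : ℕ) :
    K.obj (op (SimplexCategory.mk n)) ⟶ K.obj (op (SimplexCategory.mk (n + 1))) :=
  K.σ (Fin.last n)

/-- The top degeneracy repeats the last object and the décalage forgets the copy. Thus every
simplex, even a vertex, is visible in the décalage. -/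
theorem decOperadicNerve_topDegen {n : ℕ} (x : (operadicNerve S).obj (op (.mk n))) :
    (decOperadicNerve S).app (op (.mk n)) (topDegen _ n x) = x.1 := by
  have hl : (SimplexCategory.σ (Fin.last n)).toOrderHom (Fin.last (n + 1)) = Fin.last n :=
    Fin.predAbove_right_last
  have ht : S.IsTerm (x.1.obj ((SimplexCategory.σ (Fin.last n)).toOrderHom (Fin.last (n + 1)))) :=
    hl.symm ▸ x.2
  refine Eq.trans (congrArg ((castSuccHom (n + 1)).monotone.functor ⋙ ·)
      (S.pull_term x.1 (SimplexCategory.σ (Fin.last n)).toOrderHom _ _ ht)) ?_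
  have : (SimplexCategory.σ (Fin.last n)).toOrderHom.comp (castSuccHom (n + 1)) = .id := by
    ext i : 2
    exact Fin.predAbove_last_castSucc (i := i)
  exact congrArg (fun b : Fin (n + 1) →o Fin (n + 1) => b.monotone.functor ⋙ x.1) this

end


/-! ### Unary operadic categories as categories with a unary structure -/

namespace FinOrdinal

theorem hom_heq {a b a' b' : FinOrdinal} (ha : a = a') (hb : b = one) (hb' : b' = one)
    (f : a ⟶ b) (g : a' ⟶ b') : f ≍ g := by
  subst ha hb hb'
  exact heq_of_eq (funext fun _ => Subsingleton.elim (α := Fin 1) _ _)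

theorem subsingleton_of_eq_one {a : FinOrdinal} (h : a = one) : Subsingleton (Fin a.n) := by
  subst h
  exact inferInstanceAs (Subsingleton (Fin 1))

theorem fibre_eq_one {a b : FinOrdinal} (ha : a = one) (hb : b = one) (f : a ⟶ b) (i : Fin b.n) :
    fibre f i = one := by
  subst ha hb
  have : fibreSet f i = Finset.univ :=
    Finset.filter_true_of_mem fun _ _ => Subsingleton.elim (α := Fin 1) _ _
  rw [fibre, this]
  rfl

end FinOrdinal

theorem LocalTerminals.eq_term_of_hom {C : Type u} [Category.{v} C] (t : LocalTerminals C) {X : C}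
    {c : CategoryTheory.ConnectedComponents C} (f : X ⟶ t.term c) : c = CategoryTheory.ConnectedComponents.mk X :=
  ((Quotient.sound (Zigzag.of_hom f)).trans (t.term_mem c)).symm

namespace OpCat

theorem subsingleton_card {A : OpCat.{u}} (hA : isUnary A) (X : A.carrier) : Subsingleton (Fin (A.str.card.obj X).n) :=
  FinOrdinal.subsingleton_of_eq_one (hA X)

variable (A : OpCat.{u}) (hA : isUnary A)

/-- The only element of the cardinality of an object of a unary operadic category. -/
def point (X : A.carrier) : Fin (A.str.card.obj X).n :=
  Fin.cast (congrArg FinOrdinal.n (hA X).symm) (0 : Fin 1)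

/-- The unary structure of a unary operadic category. -/
def unaryStructure : UnaryStructure A.carrier where
  IsTerm X := ∃ c, X = A.str.term c
  fib X := A.str.fibreFunctor X (A.point hA X)
  exists_term X := ⟨_, ⟨_, rfl⟩, ⟨A.str.τ X⟩⟩
  term_uniq := by
    rintro X _ _ ⟨c, rfl⟩ ⟨c', rfl⟩ f g
    rw [A.str.eq_term_of_hom f, A.str.eq_term_of_hom g]
  hom_uniq := by
    rintro X _ ⟨c, rfl⟩ f g
    obtain rfl := A.str.eq_term_of_hom f
    exact (A.str.τ_uniq X f).trans (A.str.τ_uniq X g).symm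
  isTerm_fib_id X := A.isOperadic.fibre_id X _
  fib_obj_term := by
    rintro _ ⟨c, rfl⟩ ⟨Y, ⟨⟨⟩⟩, (f : Y ⟶ _)⟩
    obtain rfl := A.str.eq_term_of_hom f
    obtain rfl := A.str.τ_uniq Y f
    exact A.isOperadic.fibre_τ Y _
  fib_map_term := by
    rintro _ ⟨c, rfl⟩ A' ⟨Y, ⟨⟨⟩⟩, (f : Y ⟶ _)⟩ u
    obtain rfl := A.str.eq_term_of_hom f
    obtain rfl := A.str.τ_uniq Y f
    obtain ⟨Z, ⟨⟨⟩⟩, k⟩ := A'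
    obtain ⟨(g : Z ⟶ Y), (hg : g ≫ A.str.τ Y = k), rfl⟩ := Over.homMk_surjective u
    subst hg
    exact A.isOperadic.fibreMap_τ g _
  fib_obj_fib_map := by
    rintro X A' ⟨Y, ⟨⟨⟩⟩, (f : Y ⟶ X)⟩ u
    obtain ⟨Z, ⟨⟨⟩⟩, k⟩ := A'
    obtain ⟨(g : Z ⟶ Y), (hk : g ≫ f = k), rfl⟩ := Over.homMk_surjective u
    subst hk
    let i := A.point hA X
    have (X : A.carrier) := subsingleton_card hA X
    let j := Fin.cast (congrArg FinOrdinal.n (A.isOperadic.card_fibre f i))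
      (A.point hA (A.str.fibre f i))
    exact (A.isOperadic.fibre_fibreMap g f i j).trans
      (congrArg (A.str.fibre g) (Subsingleton.elim _ _))
  fib_map_fib_map := by
    rintro X A' B' ⟨Y, ⟨⟨⟩⟩, (f : Y ⟶ X)⟩ w u
    obtain ⟨Z, ⟨⟨⟩⟩, k⟩ := B'
    obtain ⟨(g : Z ⟶ Y), (hk : g ≫ f = k), rfl⟩ := Over.homMk_surjective u
    subst hk
    obtain ⟨W, ⟨⟨⟩⟩, k⟩ := A'
    obtain ⟨(h : W ⟶ Z), (hk : h ≫ g ≫ f = k), rfl⟩ := Over.homMk_surjective w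
    subst hk
    let i := A.point hA X
    have (X : A.carrier) := subsingleton_card hA X
    let j := Fin.cast (congrArg FinOrdinal.n (A.isOperadic.card_fibre f i))
      (A.point hA (A.str.fibre f i))
    have hj : FinOrdinal.fibreIncl (A.str.card.map f) i j = A.point hA Y := Subsingleton.elim _ _
    have H := A.isOperadic.fibreMap_fibreMap h g f i j
    rw [hj] at H
    exact H

variable {A} {B : OpCat.{u}} {hA} {hB : isUnary B}

theorem IsOperadicFunctor.isMap {F : A.carrier ⥤ B.carrier} (hF : IsOperadicFunctor F) :
    (A.unaryStructure hA).IsMap (B.unaryStructure hB) F where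
  isTerm := by
    rintro _ ⟨c, rfl⟩
    refine ⟨_, Eq.trans ?_ (hF.map_u (A.str.term c))⟩
    rw [LocalTerminals.u, A.str.term_mem]
  fib_comp X := by
    have := subsingleton_card hB (F.obj X)
    have hi : Fin.cast (congrArg (fun G : A.carrier ⥤ FinOrdinal => (G.obj X).n)
      hF.comp_card.symm) (A.point hA X) = B.point hB (F.obj X) := this.elim _ _
    refine Functor.hext ?_ ?_
    · rintro ⟨Y, ⟨⟨⟩⟩, (f : Y ⟶ X)⟩
      exact (hF.map_fibre f _).trans (congrArg (B.str.fibre (F.map f)) hi)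
    · rintro A' ⟨Y, ⟨⟨⟩⟩, (f : Y ⟶ X)⟩ u
      obtain ⟨Z, ⟨⟨⟩⟩, k⟩ := A'
      obtain ⟨(g : Z ⟶ Y), (hk : g ≫ f = k), rfl⟩ := Over.homMk_surjective u
      subst hk
      have H := hF.map_fibreMap g f (A.point hA X)
      rw [hi] at H
      exact H.trans (map_homMk_heq _ (F.map_comp g f).symm rfl (F.map_comp g f).symm)

/-- All cardinalities are `1`, so the conditions on them are automatic and the index of a fibre
carries no information. -/
theorem isOperadicFunctor_of_isMap {F : A.carrier ⥤ B.carrier}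
    (hF : (A.unaryStructure hA).IsMap (B.unaryStructure hB) F) : IsOperadicFunctor F := by
  have hc : F ⋙ B.str.card = A.str.card :=
    Functor.hext (fun X => (hB _).trans (hA X).symm) fun X Y f =>
      FinOrdinal.hom_heq ((hB _).trans (hA X).symm) (hB _) (hA _) _ _
  have hp (X : A.carrier) (i : Fin (A.str.card.obj X).n) : i = A.point hA X :=
    (subsingleton_card hA X).elim _ _
  have hp' (X : A.carrier) : Fin.cast (congrArg (fun G : A.carrier ⥤ FinOrdinal => (G.obj X).n)
      hc.symm) (A.point hA X) = B.point hB (F.obj X) :=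
    (subsingleton_card hB (F.obj X)).elim _ _
  exact
  { map_u X := by
      obtain ⟨c, hc⟩ := hF.isTerm ⟨_, (rfl : A.str.u X = _)⟩
      -- A morphism into a chosen terminal identifies its component, which forces F(uX) = u(FX).
      have f : F.obj X ⟶ B.str.term c := F.map (A.str.τ X) ≫ eqToHom hc
      rw [hc, B.str.eq_term_of_hom f]
    comp_card := hc
    map_fibre {Y X} f i := by
      obtain rfl := hp X i
      rw [hp']
      exact Functor.congr_obj (hF.fib_comp X) (Over.mk f)
    map_fibreMap {Z Y X} g f i := by
      obtain rfl := hp X i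
      rw [hp']
      exact (Functor.hcongr_hom (hF.fib_comp X)
        (Over.homMk g : Over.mk (g ≫ f) ⟶ Over.mk f)).trans
          (map_homMk_heq _ (F.map_comp g f) (F.map_comp g f).symm rfl) }

end OpCat

/-! ### Full faithfulness of the nerve functor -/

/-- The nerve functor from unary operadic categories to simplicial sets. -/
def unaryNerve : UnaryOpCat.{u} ⥤ SSet.{u} where
  obj A := operadicNerve (A.obj.unaryStructure A.property)
  map f := operadicNerveMap (OpCat.IsOperadicFunctor.isMap f.hom.isOperadicFunctor)

/-- The décalage of the nerve of a unary operadic category is the nerve of its underlying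
category. -/
noncomputable def unaryNerveCompDec :
    unaryNerve.{u} ⋙ dec ≅ OpCat.isUnary.ι ⋙ OpCat.forget ⋙ nerveFunctor :=
  NatIso.ofComponents
    (fun A => decOperadicNerveIso (A.obj.unaryStructure A.property))
    (fun {A B} f => decOperadicNerve_naturality (S := A.obj.unaryStructure A.property)
      (T := B.obj.unaryStructure B.property) (OpCat.IsOperadicFunctor.isMap f.hom.isOperadicFunctor))

instance : OpCat.forget.{u}.Faithful where
  map_injective h := OpCat.Hom.ext (congrArg Cat.Hom.toFunctor h)

instance : unaryNerve.{u}.Faithful :=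
  have := Functor.Faithful.of_iso unaryNerveCompDec.symm
  Functor.Faithful.of_comp unaryNerve dec

section

variable {C D : Type u} [SmallCategory C] [SmallCategory D] {S : UnaryStructure C}
  {T : UnaryStructure D}

theorem exists_eq_operadicNerveMap (φ : operadicNerve S ⟶ operadicNerve T) :
    ∃ (F : C ⥤ D) (hF : S.IsMap T F), operadicNerveMap hF = φ := by
  -- Up to the isomorphisms with ordinary nerves, D(φ) is a map of nerves, hence comes from a
  -- functor.
  obtain ⟨F, hF⟩ : ∃ F : C ⥤ D, dec.map φ ≫ decOperadicNerve T =
      decOperadicNerve S ≫ nerveMap F := by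
    obtain ⟨F, hF⟩ := nerveFunctor.{u, u}.map_surjective (X := Cat.of C) (Y := Cat.of D)
      ((decOperadicNerveIso S).inv ≫ dec.map φ ≫ decOperadicNerve T)
    exact ⟨F.toFunctor, (Iso.inv_comp_eq _).1 hF.symm⟩
  have hφ (n : ℕ) (x : (operadicNerve S).obj (op (.mk n))) :
      (φ.app _ x).1 = x.1 ⋙ F := by
    rw [← decOperadicNerve_topDegen, ← decOperadicNerve_topDegen S x]
    have h := ConcreteCategory.congr_hom (NatTrans.congr_app hF (op (.mk n)))
      (topDegen _ n x)
    refine Eq.trans ?_ h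
    exact congrArg ((decOperadicNerve T).app (op (.mk n)))
      (ConcreteCategory.congr_hom (φ.naturality (SimplexCategory.σ (Fin.last n)).op) x).symm
  have hterm {X : C} (hX : S.IsTerm X) : T.IsTerm (F.obj X) := by
    let x : (operadicNerve S).obj (op (.mk 0)) := ⟨ComposableArrows.mk₀ X, hX⟩
    have := (φ.app _ x).2
    rw [hφ] at this
    exact this
  -- Prolong `G` by a local terminal. The top face of the resulting simplex is the chain of fibres
  -- over the last object of `G`, and φ commutes with this face.
  have hpull {n : ℕ} (G : Fin (n + 1) ⥤ C) : S.pull G .id (Fin.last n) Fin.le_last ⋙ F =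
      T.pull (G ⋙ F) .id (Fin.last n) Fin.le_last := by
    obtain ⟨x, hx, rfl⟩ := S.exists_chain G
    let x' : (operadicNerve S).obj (op (.mk (n + 1))) := ⟨x, hx⟩
    let d : SimplexCategory.mk n ⟶ SimplexCategory.mk (n + 1) :=
      SimplexCategory.Hom.mk (castSuccHom (n + 1))
    have h := congrArg Subtype.val (ConcreteCategory.congr_hom (φ.naturality d.op) x')
    refine (hφ n _).symm.trans (h.trans ?_)
    exact congrArg (fun G => T.pull G (castSuccHom (n + 1)) (Fin.last n).castSucc
      (fun i => (Fin.castSucc_le_castSucc_iff.2 (Fin.le_last i)))) (hφ (n + 1) x')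
  -- Chains of length one give the preservation of fibres, chains of length two that of fibre maps.
  refine ⟨F, ⟨hterm, fun X => Functor.hext (fun A => ?_) (fun A B v => ?_)⟩, ?_⟩
  · exact Functor.congr_obj (hpull (ComposableArrows.mk₁ A.hom)) 0
  · have h := Functor.hcongr_hom (hpull (ComposableArrows.mk₂ v.left B.hom))
      (homOfLE (by decide : (0 : Fin 3) ≤ 1))
    have ha : v.left ≫ B.hom = A.hom := Over.w v
    exact (OpCat.map_heq F (congrArg (fun k : A.left ⟶ X => (S.fib X).obj (Over.mk k)) ha.symm) rfl
      (map_homMk_heq _ ha.symm (Over.w v) rfl)).trans (h.trans (map_homMk_heq _ (congrArg F.map ha)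
        (F.map_comp _ _).symm ((F.map_comp _ _).symm.trans (congrArg F.map ha))))
  · ext Δ x
    exact Subtype.ext (hφ _ x).symm

instance : unaryNerve.{u}.Full where
  map_surjective {A B} φ := by
    obtain ⟨F, hF, h⟩ := exists_eq_operadicNerveMap φ
    exact ⟨⟨⟨F, OpCat.isOperadicFunctor_of_isMap hF⟩⟩, h⟩

end


/-! ### Simplicial sets whose décalage is a nerve -/

section SimplexIdentities

/-- The inclusion of `[n]` into `[n + 1]` as an initial segment. -/
abbrev topFace (n : ℕ) : SimplexCategory.mk n ⟶ SimplexCategory.mk (n + 1) :=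
  SimplexCategory.Hom.mk (castSuccHom (n + 1))

/-- The surjection of `[n + 1]` onto `[n]` that identifies the top two elements. -/
abbrev topCollapse (n : ℕ) : SimplexCategory.mk (n + 1) ⟶ SimplexCategory.mk n :=
  SimplexCategory.σ (Fin.last n)

theorem topCollapse_castSucc {n : ℕ} (i : Fin (n + 1)) :
    (topCollapse n).toOrderHom i.castSucc = i :=
  Fin.predAbove_last_castSucc

theorem topCollapse_last (n : ℕ) :
    (topCollapse n).toOrderHom (Fin.last (n + 1)) = Fin.last n :=
  Fin.predAbove_right_last

theorem simplex_hom_ext {m n : ℕ} {f g : SimplexCategory.mk (m + 1) ⟶ SimplexCategory.mk n}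
    (h : ∀ i : Fin (m + 1), f.toOrderHom i.castSucc = g.toOrderHom i.castSucc)
    (hl : f.toOrderHom (Fin.last _) = g.toOrderHom (Fin.last _)) : f = g := by
  ext i : 3
  induction i using Fin.lastCases with
  | last => exact hl
  | cast i => exact h i

theorem topFace_comp_topCollapse (n : ℕ) : topFace n ≫ topCollapse n = 𝟙 _ := by
  ext i : 3
  exact topCollapse_castSucc i

theorem topFace_comp_addTop {m n : ℕ} (a : SimplexCategory.mk m ⟶ SimplexCategory.mk n) :
    topFace m ≫ addTop.map a = a ≫ topFace n := by
  ext i : 3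
  exact addTopHom_castSucc _ i

theorem addTop_topFace_comp_topCollapse (n : ℕ) :
    addTop.map (topFace n) ≫ topCollapse (n + 1) = 𝟙 (SimplexCategory.mk (n + 1)) :=
  simplex_hom_ext
    (fun i => (congrArg (topCollapse (n + 1)).toOrderHom (addTopHom_castSucc _ i)).trans
      (topCollapse_castSucc _))
    ((congrArg (topCollapse (n + 1)).toOrderHom (addTopHom_last _)).trans (topCollapse_last _))

theorem addTop_addTop_comp_topCollapse {m n : ℕ}
    (a : SimplexCategory.mk m ⟶ SimplexCategory.mk n) :
    addTop.map (addTop.map a) ≫ topCollapse (n + 1) = topCollapse (m + 1) ≫ addTop.map a :=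
  simplex_hom_ext
    (fun i => ((congrArg (topCollapse (n + 1)).toOrderHom (addTopHom_castSucc _ i)).trans
      (topCollapse_castSucc _)).trans
        (congrArg (addTop.map a).toOrderHom (topCollapse_castSucc i)).symm)
    (((congrArg (topCollapse (n + 1)).toOrderHom (addTopHom_last _)).trans
      (topCollapse_last _)).trans
        ((congrArg (addTop.map a).toOrderHom (topCollapse_last _)).trans (addTopHom_last _)).symm)

/-- The last vertex of a simplex. -/
abbrev lastVertex (n : ℕ) : SimplexCategory.mk 0 ⟶ SimplexCategory.mk n :=
  SimplexCategory.const _ _ (Fin.last n)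

theorem addTop_lastVertex_comp_topCollapse (n : ℕ) :
    addTop.map (lastVertex n) ≫ topCollapse n = topCollapse 0 ≫ lastVertex n :=
  simplex_hom_ext
    (fun i => (congrArg (topCollapse n).toOrderHom (addTopHom_castSucc _ i)).trans
      (topCollapse_castSucc _))
    ((congrArg (topCollapse n).toOrderHom (addTopHom_last _)).trans (topCollapse_last _))

theorem map_map_of_eq (K : SSet.{u}) {a b c : SimplexCategory} {f : a ⟶ b} {g : b ⟶ c} {h : a ⟶ c}
    (hfg : f ≫ g = h) (x : K.obj (op c)) : K.map f.op (K.map g.op x) = K.map h.op x := by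
  subst hfg
  exact (ConcreteCategory.congr_hom (K.map_comp g.op f.op) x).symm

theorem map_id_of_eq (K : SSet.{u}) {a : SimplexCategory} {f : a ⟶ a}
    (hf : f = 𝟙 a) (x : K.obj (op a)) : K.map f.op x = x := by
  subst hf
  exact ConcreteCategory.congr_hom (K.map_id (op a)) x

end SimplexIdentities

theorem comp_heq_of_heq_id {C : Type*} [Category* C] {X Y Z T : C} (f : X ⟶ Y) (g : Y ⟶ Z)
    (hY : Y = T) (hZ : Z = T) (hg : g ≍ 𝟙 T) : f ≫ g ≍ f := by
  subst hY hZ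
  obtain rfl := eq_of_heq hg
  rw [Category.comp_id]

theorem arrow_ext {C : Type u} [SmallCategory C] {F G : ComposableArrows C 1}
    (h0 : F.obj 0 = G.obj 0) (h1 : F.obj 1 = G.obj 1)
    (h : F.map (homOfLE (by decide : (0 : Fin 2) ≤ 1)) ≍ G.map (homOfLE (by decide : (0 : Fin 2) ≤ 1))) : F = G :=
  ComposableArrows.ext₁ h0 h1 ((conj_eqToHom_iff_heq _ _ h0 h1).2 h)

/-! ### Local terminals and fibres extracted from a simplicial set -/

namespace DecNerve

variable {K : SSet.{u}} {C : Type u} [SmallCategory C] (e : dec.obj K ≅ nerve C)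

/-- The simplex of `K` that corresponds to a chain. -/
def ofChain {n : ℕ} (G : ComposableArrows C n) : K.obj (op (.mk (n + 1))) :=
  e.inv.app (op (.mk n)) G

/-- The chain that corresponds to a simplex of `K`. -/
def toChain {n : ℕ} (x : K.obj (op (.mk (n + 1)))) : ComposableArrows C n :=
  e.hom.app (op (.mk n)) x

@[simp]
theorem toChain_ofChain {n : ℕ} (G : ComposableArrows C n) : toChain e (ofChain e G) = G :=
  ConcreteCategory.congr_hom (e.inv_hom_id_app (op (.mk n))) G

@[simp]
theorem ofChain_toChain {n : ℕ} (x : K.obj (op (.mk (n + 1)))) : ofChain e (toChain e x) = x :=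
  ConcreteCategory.congr_hom (e.hom_inv_id_app (op (.mk n))) x

theorem toChain_map {m n : ℕ} (a : SimplexCategory.mk m ⟶ SimplexCategory.mk n)
    (x : K.obj (op (.mk (n + 1)))) :
    toChain e (K.map (addTop.map a).op x) = a.toOrderHom.monotone.functor ⋙ toChain e x :=
  ConcreteCategory.congr_hom (e.hom.naturality a.op) x

theorem ofChain_comp {m n : ℕ} (a : SimplexCategory.mk m ⟶ SimplexCategory.mk n)
    (G : ComposableArrows C n) :
    ofChain e (a.toOrderHom.monotone.functor ⋙ G) = K.map (addTop.map a).op (ofChain e G) :=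
  ConcreteCategory.congr_hom (e.inv.naturality a.op) G

/-- An object is a local terminal if it is degenerate as a `1`-simplex of `K`. -/
def IsTerm (X : C) : Prop :=
  ∃ k : K.obj (op (.mk 0)), ofChain e (ComposableArrows.mk₀ X) = K.map (topCollapse 0).op k

theorem isTerm_last {n : ℕ} (x : K.obj (op (.mk n))) :
    IsTerm e ((toChain e (K.map (topCollapse n).op x)).obj (Fin.last n)) := by
  refine ⟨K.map (lastVertex n).op x, ?_⟩
  have h : ComposableArrows.mk₀ ((toChain e (K.map (topCollapse n).op x)).obj (Fin.last n)) =
      (lastVertex n).toOrderHom.monotone.functor ⋙ toChain e (K.map (topCollapse n).op x) :=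
    ComposableArrows.ext₀ rfl
  rw [h, ofChain_comp, ofChain_toChain]
  exact (map_map_of_eq K (addTop_lastVertex_comp_topCollapse n) x).trans
    (map_map_of_eq K rfl x).symm

/-- The face that omits the second-highest vertex cancels the top degeneracy. So the top degeneracy
prolongs a chain by one object without changing its beginning. -/
theorem init_toChain_topCollapse {n : ℕ} (x : K.obj (op (.mk (n + 1)))) :
    (castSuccHom (n + 1)).monotone.functor ⋙ toChain e (K.map (topCollapse (n + 1)).op x) =
      toChain e x :=
  (toChain_map e (topFace n) _).symm.trans (congrArg (toChain e)
    ((map_map_of_eq K (addTop_topFace_comp_topCollapse n) x).trans (map_id_of_eq K rfl x)))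

/-- The right-hand side depends on `X` only, which yields existence and uniqueness of maps to local
terminals at once. The top degeneracy prolongs `f` to a chain X → T → Z. Its second map is an
identity because `T` is degenerate, so `f` equals the composite, which naturality identifies with
the canonical edge of `X`. -/
theorem mk₁_eq_of_isTerm {X T : C} (hT : IsTerm e T) (f : X ⟶ T) :
    ComposableArrows.mk₁ f =
      toChain e (K.map (topCollapse 1).op (ofChain e (ComposableArrows.mk₀ X))) := by
  obtain ⟨k, hk⟩ := hT
  let G : ComposableArrows C 2 :=
    toChain e (K.map (topCollapse 2).op (ofChain e (ComposableArrows.mk₁ f)))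
  have hG (a : SimplexCategory.mk 0 ⟶ SimplexCategory.mk 1) :
      (addTop.map a).toOrderHom.monotone.functor ⋙ G =
        toChain e (K.map (topCollapse 1).op
          (ofChain e (a.toOrderHom.monotone.functor ⋙ ComposableArrows.mk₁ f))) := by
    rw [ofChain_comp]
    refine (toChain_map e (addTop.map a) _).symm.trans (congrArg (toChain e) ?_)
    exact (map_map_of_eq K (addTop_addTop_comp_topCollapse a) _).trans
      (map_map_of_eq K rfl _).symm
  have h01 : (castSuccHom 2).monotone.functor ⋙ G = ComposableArrows.mk₁ f :=
    (init_toChain_topCollapse e _).trans (toChain_ofChain e _)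
  have h12 : (addTop.map (SimplexCategory.const (.mk 0) (.mk 1) 1)).toOrderHom.monotone.functor ⋙ G
      = ComposableArrows.mk₁ (𝟙 T) := by
    rw [hG]
    have h : (SimplexCategory.const (.mk 0) (.mk 1) 1).toOrderHom.monotone.functor ⋙
      ComposableArrows.mk₁ f = ComposableArrows.mk₀ T := ComposableArrows.ext₀ rfl
    rw [h, hk]
    -- On a totally degenerate simplex the top degeneracy agrees with one coming from the décalage,
    -- and the latter is an identity in the nerve.
    have hs : topCollapse 1 ≫ topCollapse 0 = addTop.map (topCollapse 0) ≫ topCollapse 0 := by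
      ext i : 3
      exact Subsingleton.elim (α := Fin 1) _ _
    rw [map_map_of_eq K hs]
    refine (congrArg (toChain e) (map_map_of_eq K rfl k).symm).trans
      ((toChain_map e (topCollapse 0) (K.map (topCollapse 0).op k)).trans ?_)
    rw [← hk, toChain_ofChain]
    exact nerve.σ₀_mk₀_eq T
  have h02 := hG (SimplexCategory.const (.mk 0) (.mk 1) 0)
  have h : (SimplexCategory.const (.mk 0) (.mk 1) 0).toOrderHom.monotone.functor ⋙
    ComposableArrows.mk₁ f = ComposableArrows.mk₀ X := ComposableArrows.ext₀ rfl
  rw [h] at h02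
  rw [← h02, ← h01]
  have hY : G.obj 1 = T := Functor.congr_obj h12 0
  have hZ : G.obj 2 = T := Functor.congr_obj h12 1
  have hg : G.map (homOfLE (by decide : (1 : Fin 3) ≤ 2)) ≍ 𝟙 T :=
    Functor.hcongr_hom h12 (homOfLE (by decide : (0 : Fin 2) ≤ 1))
  refine arrow_ext rfl (hY.trans hZ.symm) ?_
  have := comp_heq_of_heq_id (G.map (homOfLE (by decide : (0 : Fin 3) ≤ 1)))
    (G.map (homOfLE (by decide : (1 : Fin 3) ≤ 2))) hY hZ hg
  rw [← G.map_comp] at this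
  exact this.symm

theorem uniq {X T T' : C} (hT : IsTerm e T) (hT' : IsTerm e T') (f : X ⟶ T) (g : X ⟶ T') :
    T = T' ∧ f ≍ g := by
  have h := (mk₁_eq_of_isTerm e hT f).trans (mk₁_eq_of_isTerm e hT' g).symm
  exact ⟨Functor.congr_obj h 1, Functor.hcongr_hom h (homOfLE (by decide : (0 : Fin 2) ≤ 1))⟩

theorem exists_term (X : C) : ∃ T, IsTerm e T ∧ Nonempty (X ⟶ T) := by
  let x := ofChain e (ComposableArrows.mk₀ X)
  have h : (toChain e (K.map (topCollapse 1).op x)).obj 0 = X :=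
    Functor.congr_obj ((init_toChain_topCollapse e x).trans (toChain_ofChain e _)) 0
  exact ⟨_, isTerm_last e x, ⟨eqToHom h.symm ≫
    (toChain e (K.map (topCollapse 1).op x)).map (homOfLE (by decide : (0 : Fin 2) ≤ 1))⟩⟩

/-- Both sides correspond to chains with the same beginning and a local terminal at the end, so
`chain_ext` applies. -/
theorem ofChain_eq_of_isTerm {n : ℕ} (G : ComposableArrows C (n + 1))
    (hG : IsTerm e (G.obj (Fin.last _))) :
    ofChain e G = K.map (topCollapse (n + 1)).op
      (ofChain e ((castSuccHom (n + 1)).monotone.functor ⋙ G)) := by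
  have h : G = toChain e (K.map (topCollapse (n + 1)).op
      (ofChain e ((castSuccHom (n + 1)).monotone.functor ⋙ G))) :=
    chain_ext (uniq e) ((init_toChain_topCollapse e _).trans (toChain_ofChain e _)).symm hG
      (isTerm_last e _)
  exact (congrArg (ofChain e) h).trans (ofChain_toChain e _)

/-- The operation on chains that corresponds to the top face map of `K`. -/
def face {n : ℕ} (G : ComposableArrows C (n + 1)) : ComposableArrows C n :=
  toChain e (K.map (topFace (n + 1)).op (ofChain e G))

theorem face_comp {m n : ℕ} (a : SimplexCategory.mk m ⟶ SimplexCategory.mk n)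
    (G : ComposableArrows C (n + 1)) :
    face e ((addTopHom a.toOrderHom).monotone.functor ⋙ G) =
      a.toOrderHom.monotone.functor ⋙ face e G := by
  refine Eq.trans ?_ (toChain_map e a _)
  refine congrArg (toChain e) ?_
  refine (congrArg (K.map (topFace (m + 1)).op) (ofChain_comp e (addTop.map a) G)).trans ?_
  exact (map_map_of_eq K (topFace_comp_addTop (addTop.map a)) _).trans (map_map_of_eq K rfl _).symm

/-- This is the simplicial identity for two successive top faces: dropping the last object of a
chain is, in `K`, the face that omits the second-highest vertex. -/
theorem face_face {n : ℕ} (G : ComposableArrows C (n + 2)) :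
    face e (face e G) = face e ((castSuccHom (n + 2)).monotone.functor ⋙ G) := by
  refine congrArg (toChain e) ?_
  rw [face, ofChain_toChain]
  refine Eq.trans ?_ (congrArg (K.map (topFace (n + 1)).op)
    (ofChain_comp e (topFace (n + 1)) G)).symm
  exact (map_map_of_eq K rfl _).trans (map_map_of_eq K (topFace_comp_addTop (topFace (n + 1))) _).symm

/-- The simplex is a top degeneracy, which the top face cancels. This becomes the triviality of
fibres over local terminals. -/
theorem face_of_isTerm {n : ℕ} (G : ComposableArrows C (n + 1))
    (hG : IsTerm e (G.obj (Fin.last _))) :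
    face e G = (castSuccHom (n + 1)).monotone.functor ⋙ G := by
  rw [face, ofChain_eq_of_isTerm e G hG,
    map_map_of_eq K rfl, map_id_of_eq K (topFace_comp_topCollapse (n + 1)), toChain_ofChain]

/-- The map of nerves that defines the fibre functors. -/
noncomputable def fibNerve (X : C) : nerve (Over X) ⟶ nerve C where
  app Δ := ↾fun H => face e (snoc H : ComposableArrows C (Δ.unop.len + 1))
  naturality _ _ f := by
    refine ConcreteCategory.hom_ext _ _ fun H => ?_
    exact (congrArg (face e) (snoc_comp H f.unop.toOrderHom)).trans (face_comp e f.unop _)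

/-- The fibre functors. -/
noncomputable def fib (X : C) : Over X ⥤ C :=
  (nerveFunctor.preimage (X := Cat.of (Over X)) (Y := Cat.of C) (fibNerve e X)).toFunctor

theorem comp_fib {X : C} {n : ℕ} (H : ComposableArrows (Over X) n) :
    H ⋙ fib e X = face e (snoc H : ComposableArrows C (n + 1)) :=
  ConcreteCategory.congr_hom (NatTrans.congr_app (nerveFunctor.map_preimage
    (X := Cat.of (Over X)) (Y := Cat.of C) (fibNerve e X)) (op (.mk n))) H

theorem overLast_comp_fib {n : ℕ} (G : ComposableArrows C (n + 1)) :
    overLast G ⋙ fib e (G.obj (Fin.last _)) = face e G :=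
  (comp_fib e _).trans (congrArg (face e) (snoc_overLast G))

end DecNerve
-- The reconstructed unary structure and its nerve
namespace DecNerve

variable {K : SSet.{u}} {C : Type u} [SmallCategory C] (e : dec.obj K ≅ nerve C)

/-- The identity of `X` is a degenerate chain; moving the top face past the degeneracy leaves a
degenerate 1-simplex. -/
theorem isTerm_fib_id (X : C) : IsTerm e ((fib e X).obj (Over.mk (𝟙 X))) := by
  have h : face e (ComposableArrows.mk₁ (𝟙 X)) = toChain e (K.map (topCollapse 0).op
      (K.map (topFace 0).op (ofChain e (ComposableArrows.mk₀ X)))) := by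
    have h' : ComposableArrows.mk₁ (𝟙 X) =
      (topCollapse 0).toOrderHom.monotone.functor ⋙ ComposableArrows.mk₀ X :=
      (nerve.σ₀_mk₀_eq X).symm
    rw [h']
    refine congrArg (toChain e) ((congrArg (K.map (topFace 1).op)
      (ofChain_comp e (topCollapse 0) _)).trans ?_)
    exact (map_map_of_eq K (topFace_comp_addTop (topCollapse 0)) _).trans
      (map_map_of_eq K rfl _).symm
  have h' := Functor.congr_obj ((overLast_comp_fib e (ComposableArrows.mk₁ (𝟙 X))).trans h) 0
  exact (congrArg (IsTerm e) h').mpr (isTerm_last e (n := 0) _)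

theorem comp_fib_of_isTerm {T : C} (hT : IsTerm e T) {n : ℕ} (H : ComposableArrows (Over T) n) :
    H ⋙ fib e T = H ⋙ Over.forget T := by
  rw [comp_fib, face_of_isTerm, castSucc_comp_snoc]
  rwa [snoc_last]

/-- `face_face` in terms of fibres; chains of length one and two give the two iteration axioms. -/
theorem overLast_comp_fib_comp_fib {X : C} {n : ℕ} (H : ComposableArrows (Over X) (n + 1)) :
    overLast (H ⋙ fib e X) ⋙ fib e ((fib e X).obj (H.obj (Fin.last _))) =
      overLast (H ⋙ Over.forget X) ⋙ fib e (H.obj (Fin.last _)).left := by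
  refine (overLast_comp_fib e (H ⋙ fib e X)).trans (Eq.trans ?_
    (overLast_comp_fib e (H ⋙ Over.forget X)).symm)
  rw [comp_fib, face_face, castSucc_comp_snoc]

/-- The unary structure on a category `C` that is determined by a simplicial set whose décalage
is the nerve of `C`. -/
noncomputable def unaryStructure : UnaryStructure C where
  IsTerm := IsTerm e
  fib := fib e
  exists_term := exists_term e
  term_uniq hT hT' f g := (uniq e hT hT' f g).1
  hom_uniq hT f g := eq_of_heq (uniq e hT hT f g).2
  isTerm_fib_id := isTerm_fib_id e
  fib_obj_term hT A := Functor.congr_obj (comp_fib_of_isTerm e hT (ComposableArrows.mk₀ A)) 0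
  fib_map_term hT _ _ w := Functor.hcongr_hom (comp_fib_of_isTerm e hT (ComposableArrows.mk₁ w))
    (homOfLE (by decide : (0 : Fin 2) ≤ 1))
  fib_obj_fib_map w :=
    Functor.congr_obj (overLast_comp_fib_comp_fib e (ComposableArrows.mk₁ w)) 0
  fib_map_fib_map {X A B D} w v := by
    refine (map_homMk_heq _ ((fib e X).map_comp w v).symm rfl ((fib e X).map_comp w v).symm).trans
      ((Functor.hcongr_hom (overLast_comp_fib_comp_fib e (ComposableArrows.mk₂ w v))
        (homOfLE (by decide : (0 : Fin 2) ≤ 1))).trans ?_)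
    exact map_homMk_heq _ (rfl : (w ≫ v).left = w.left ≫ v.left) rfl rfl

/-- A simplicial set whose décalage is the nerve of `C` maps to the nerve of the unary structure
on `C`. -/
noncomputable def toOperadicNerve : K ⟶ operadicNerve (unaryStructure e) where
  app Δ := ↾fun x => ⟨toChain e (K.map (topCollapse Δ.unop.len).op x), isTerm_last e x⟩
  naturality X Y a := by
    refine ConcreteCategory.hom_ext _ _ fun x => Subtype.ext ?_
    let f : SimplexCategory.mk Y.unop.len ⟶ SimplexCategory.mk X.unop.len := a.unop
    let y := K.map (topCollapse X.unop.len).op x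
    -- `b` is `f` with its last value repeated. Restricting the chain of `y` along `b` thus records
    -- both the restriction along `f` and the object over which fibres are taken.
    let b := topCollapse Y.unop.len ≫ f
    have hb : b.toOrderHom.comp (castSuccHom _) = f.toOrderHom := by
      ext i : 2
      exact congrArg f.toOrderHom (topCollapse_castSucc i)
    have hl : b.toOrderHom (Fin.last _) = f.toOrderHom (Fin.last _) :=
      congrArg f.toOrderHom (topCollapse_last _)
    refine Eq.trans ?_ ((unaryStructure e).pull_congr (toChain e y) hb hl
      (fun i => b.toOrderHom.monotone (Fin.le_last _))
      (fun i => f.toOrderHom.monotone (Fin.le_last i)))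
    refine Eq.trans ?_ (overLast_comp_fib e (b.toOrderHom.monotone.functor ⋙ toChain e y)).symm
    refine congrArg (toChain e) (Eq.symm ?_)
    rw [ofChain_comp, ofChain_toChain]
    have hs : (b ≫ topFace X.unop.len) ≫ topCollapse X.unop.len = b := by
      rw [Category.assoc, topFace_comp_topCollapse, Category.comp_id]
    exact (map_map_of_eq K (topFace_comp_addTop b) _).trans ((map_map_of_eq K hs x).trans
      (map_map_of_eq K rfl x).symm)

instance : IsIso (toOperadicNerve e) := by
  rw [NatTrans.isIso_iff_isIso_app]
  intro Δ
  rw [isIso_iff_bijective]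
  obtain ⟨⟨n⟩⟩ := Δ
  -- Injective since the top face splits the top degeneracy; surjective since a chain ending in a
  -- local terminal is a top degeneracy, in degree zero by the definition of `IsTerm`.
  refine ⟨fun x y h => ?_, fun F => ?_⟩
  · have h' := congrArg (fun z => K.map (topFace n).op (ofChain e z)) (congrArg Subtype.val h)
    have hx (x : K.obj (op (.mk n))) : K.map (topFace n).op
        (ofChain e (toChain e (K.map (topCollapse n).op x))) = x := by
      rw [ofChain_toChain, map_map_of_eq K rfl, map_id_of_eq K (topFace_comp_topCollapse n)]
    exact (hx x).symm.trans (h'.trans (hx y))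
  · obtain ⟨x, hx⟩ : ∃ x, ofChain e F.1 = K.map (topCollapse n).op x := by
      obtain ⟨F, hF⟩ := F
      cases n with
      | zero =>
        obtain ⟨k, hk⟩ := hF
        refine ⟨k, Eq.trans (congrArg (ofChain e) ?_) hk⟩
        exact ComposableArrows.ext₀ rfl
      | succ n => exact ⟨_, ofChain_eq_of_isTerm e F hF⟩
    refine ⟨x, Subtype.ext ?_⟩
    exact (congrArg (toChain e) hx.symm).trans (toChain_ofChain e _)

end DecNerve

/-! ### Simplicial sets that satisfy the Segal condition are nerves -/

namespace Segal

variable {X : SSet.{u}}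

/-- A vertex of a simplex. -/
def vtx {n : ℕ} (x : X.obj (op (.mk n))) (i : Fin (n + 1)) : X.obj (op (.mk 0)) :=
  X.map (SimplexCategory.const (.mk 0) (.mk n) i).op x

/-- An edge of a simplex. -/
def edge {n : ℕ} (x : X.obj (op (.mk n))) (i j : Fin (n + 1)) (h : i ≤ j) :
    X.obj (op (.mk 1)) :=
  X.map (SimplexCategory.mkOfLe i j h).op x

theorem vtx_map {m n : ℕ} (f : SimplexCategory.mk m ⟶ SimplexCategory.mk n)
    (x : X.obj (op (.mk n))) (i : Fin (m + 1)) :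
    vtx (X.map f.op x) i = vtx x (f.toOrderHom i) :=
  map_map_of_eq X rfl x

theorem edge_map {m n : ℕ} (f : SimplexCategory.mk m ⟶ SimplexCategory.mk n)
    (x : X.obj (op (.mk n))) (i j : Fin (m + 1)) (h : i ≤ j) :
    edge (X.map f.op x) i j h =
      edge x (f.toOrderHom i) (f.toOrderHom j) (f.toOrderHom.monotone h) := by
  refine map_map_of_eq X ?_ x
  ext k : 3
  fin_cases k <;> rfl

theorem vtx_edge_zero {n : ℕ} (x : X.obj (op (.mk n))) (i j : Fin (n + 1)) (h : i ≤ j) :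
    vtx (edge x i j h) 0 = vtx x i :=
  vtx_map _ _ _

theorem vtx_edge_one {n : ℕ} (x : X.obj (op (.mk n))) (i j : Fin (n + 1)) (h : i ≤ j) :
    vtx (edge x i j h) 1 = vtx x j :=
  vtx_map _ _ _

theorem edge_vtx {n : ℕ} (x : X.obj (op (.mk n))) (i : Fin (n + 1)) :
    edge (vtx x i) 0 0 le_rfl = edge x i i le_rfl :=
  edge_map (SimplexCategory.const (.mk 0) (.mk n) i) x 0 0 le_rfl

theorem edge_self (x : X.obj (op (.mk 1))) : edge x 0 1 (by decide) = x := by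
  refine map_id_of_eq X ?_ x
  ext k : 3
  fin_cases k <;> rfl

theorem vtx_self (x : X.obj (op (.mk 0))) : vtx x 0 = x :=
  map_id_of_eq X (SimplexCategory.hom_zero_zero _) x

theorem vtx_zero_eq (x : X.obj (op (.mk 1))) : vtx x 0 = X.map (SimplexCategory.δ 1).op x :=
  (congrArg (fun f => X.map (Quiver.Hom.op f) x) SimplexCategory.δ_one_eq_const).symm

theorem vtx_one_eq (x : X.obj (op (.mk 1))) : vtx x 1 = X.map (SimplexCategory.δ 0).op x :=
  (congrArg (fun f => X.map (Quiver.Hom.op f) x) SimplexCategory.δ_zero_eq_const).symm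

theorem simplex_ext [X.IsStrictSegal] {n : ℕ} {x y : X.obj (op (.mk n))}
    (hv : ∀ i, vtx x i = vtx y i)
    (he : ∀ i : Fin n, edge x i.castSucc i.succ (Fin.castSucc_le_succ i) =
      edge y i.castSucc i.succ (Fin.castSucc_le_succ i)) : x = y :=
  (SSet.IsStrictSegal.segal n).1 (SSet.Path.ext (funext hv) (funext he))

theorem exists_simplex [X.IsStrictSegal] {n : ℕ} (v : Fin (n + 1) → X.obj (op (.mk 0)))
    (a : Fin n → X.obj (op (.mk 1))) (hs : ∀ i, vtx (a i) 0 = v i.castSucc)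
    (ht : ∀ i, vtx (a i) 1 = v i.succ) :
    ∃ x : X.obj (op (.mk n)), (∀ i, vtx x i = v i) ∧
      ∀ i : Fin n, edge x i.castSucc i.succ (Fin.castSucc_le_succ i) = a i := by
  obtain ⟨x, hx⟩ := (SSet.IsStrictSegal.segal (X := X) n).2
    { vertex := v
      arrow := a
      arrow_src i := (vtx_zero_eq (a i)).symm.trans (hs i)
      arrow_tgt i := (vtx_one_eq (a i)).symm.trans (ht i) }
  exact ⟨x, fun i => SSet.Path.congr_vertex hx i, fun i => SSet.Path.congr_arrow hx i⟩

variable (X) in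
/-- The vertices of a simplicial set, as the objects of a category. -/
structure Obj where
  /-- the vertex -/
  pt : X.obj (op (.mk 0))

/-- The edges between two vertices of a simplicial set. -/
@[ext]
structure Hom (x y : Obj X) where
  /-- the edge -/
  edge : X.obj (op (.mk 1))
  src : vtx edge 0 = x.pt
  tgt : vtx edge 1 = y.pt

theorem Hom.heq {x y x' y' : Obj X} {f : Hom x y} {g : Hom x' y'} (hx : x = x') (hy : y = y')
    (h : f.edge = g.edge) : f ≍ g := by
  subst hx hy
  exact heq_of_eq (Hom.ext h)

theorem Hom.edge_eq {x y x' y' : Obj X} {f : Hom x y} {g : Hom x' y'} (hx : x = x') (hy : y = y')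
    (h : f ≍ g) : f.edge = g.edge := by
  subst hx hy
  rw [eq_of_heq h]

theorem exists_comp [X.IsStrictSegal] (f g : X.obj (op (.mk 1))) (h : vtx f 1 = vtx g 0) :
    ∃ x : X.obj (op (.mk 2)), edge x 0 1 (by decide) = f ∧ edge x 1 2 (by decide) = g := by
  obtain ⟨x, -, hx⟩ := exists_simplex (X := X) ![vtx f 0, vtx g 0, vtx g 1] ![f, g]
    (fun i => by fin_cases i <;> rfl) (fun i => by
      fin_cases i
      · exact h
      · rfl)
  exact ⟨x, hx 0, hx 1⟩

/-- An edge of a simplex, as a morphism. -/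
def edgeHom {n : ℕ} (x : X.obj (op (.mk n))) (i j : Fin (n + 1)) (h : i ≤ j) :
    Hom ⟨vtx x i⟩ ⟨vtx x j⟩ where
  edge := edge x i j h
  src := vtx_map _ _ _
  tgt := vtx_map _ _ _

variable [X.IsStrictSegal]

/-- The composite of two edges. -/
noncomputable def comp {x y z : Obj X} (f : Hom x y) (g : Hom y z) : Hom x z :=
  have h := exists_comp f.edge g.edge (f.tgt.trans g.src.symm)
  { edge := edge h.choose 0 2 (by decide)
    src := by
      have h' := congrArg (vtx · 0) h.choose_spec.1
      exact (vtx_edge_zero _ _ _ _).trans ((vtx_edge_zero _ _ _ _).symm.trans (h'.trans f.src))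
    tgt := by
      have h' := congrArg (vtx · 1) h.choose_spec.2
      exact (vtx_edge_one _ _ _ _).trans ((vtx_edge_one _ _ _ _).symm.trans (h'.trans g.tgt)) }

/-- By uniqueness of fillers, the composite may be read off from any simplex containing both edges,
not just the chosen one. -/
theorem comp_edge {n : ℕ} {x y z : Obj X} (f : Hom x y) (g : Hom y z) (s : X.obj (op (.mk n)))
    (i j k : Fin (n + 1)) (hij : i ≤ j) (hjk : j ≤ k) (hf : edge s i j hij = f.edge)
    (hg : edge s j k hjk = g.edge) : (comp f g).edge = edge s i k (hij.trans hjk) := by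
  have h := exists_comp f.edge g.edge (f.tgt.trans g.src.symm)
  have ht : h.choose = X.map (SimplexCategory.mkOfLeComp i j k hij hjk).op s := by
    have h01 : edge h.choose 0 1 (by decide) =
        edge (X.map (SimplexCategory.mkOfLeComp i j k hij hjk).op s) 0 1 (by decide) :=
      (h.choose_spec.1.trans hf.symm).trans
        (edge_map (SimplexCategory.mkOfLeComp i j k hij hjk) s 0 1 _).symm
    have h12 : edge h.choose 1 2 (by decide) =
        edge (X.map (SimplexCategory.mkOfLeComp i j k hij hjk).op s) 1 2 (by decide) :=
      (h.choose_spec.2.trans hg.symm).trans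
        (edge_map (SimplexCategory.mkOfLeComp i j k hij hjk) s 1 2 _).symm
    have hv {a b : X.obj (op (.mk 2))} {i j : Fin 3} {hij : i ≤ j}
        (h : edge a i j hij = edge b i j hij) : vtx a i = vtx b i ∧ vtx a j = vtx b j := by
      have h0 := congrArg (vtx · 0) h
      have h1 := congrArg (vtx · 1) h
      exact ⟨(vtx_edge_zero _ _ _ _).symm.trans (h0.trans (vtx_edge_zero _ _ _ _)),
        (vtx_edge_one _ _ _ _).symm.trans (h1.trans (vtx_edge_one _ _ _ _))⟩
    refine simplex_ext (fun l => ?_) (fun l => ?_)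
    · fin_cases l
      exacts [(hv h01).1, (hv h01).2, (hv h12).2]
    · fin_cases l
      exacts [h01, h12]
  exact (congrArg (edge · 0 2 (by decide)) ht).trans
    (edge_map (SimplexCategory.mkOfLeComp i j k hij hjk) s 0 2 _)

/-- The category whose morphisms are the edges of a simplicial set that satisfies the Segal
condition. -/
noncomputable instance : SmallCategory (Obj X) where
  Hom := Hom
  id x :=
    { edge := edge x.pt 0 0 le_rfl
      src := (vtx_map _ _ _).trans (vtx_self _)
      tgt := (vtx_map _ _ _).trans (vtx_self _) }
  comp := comp
  id_comp f := Hom.ext ((comp_edge _ _ f.edge 0 0 1 le_rfl (by decide)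
    ((edge_vtx _ _).symm.trans (by rw [f.src])) (edge_self _)).trans (edge_self _))
  comp_id f := Hom.ext ((comp_edge _ _ f.edge 0 1 1 (by decide) le_rfl (edge_self _)
    ((edge_vtx _ _).symm.trans (by rw [f.tgt]))).trans (edge_self _))
  assoc {x y z w} f g h := by
    -- Both bracketings are the long edge of the 3-simplex with this spine.
    obtain ⟨s, -, hs⟩ := exists_simplex (X := X) ![x.pt, y.pt, z.pt, w.pt] ![f.edge, g.edge, h.edge]
      (fun i => by
        fin_cases i
        exacts [f.src, g.src, h.src])
      (fun i => by
        fin_cases i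
        exacts [f.tgt, g.tgt, h.tgt])
    have hfg := comp_edge f g s 0 1 2 (by decide) (by decide) (hs 0) (hs 1)
    have hgh := comp_edge g h s 1 2 3 (by decide) (by decide) (hs 1) (hs 2)
    exact Hom.ext ((comp_edge _ _ s 0 2 3 (by decide) (by decide) hfg.symm (hs 2)).trans
      (comp_edge _ _ s 0 1 3 (by decide) (by decide) (hs 0) hgh.symm).symm)

/-- The chain of the vertices of a simplex. -/
noncomputable def chain {n : ℕ} (x : X.obj (op (.mk n))) : ComposableArrows (Obj X) n where
  obj i := ⟨vtx x i⟩
  map {i j} f := edgeHom x i j (leOfHom f)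
  map_id i := Hom.ext (edge_vtx x i).symm
  map_comp f g := Hom.ext
    (comp_edge _ _ x _ _ _ (leOfHom f) (leOfHom g) rfl rfl).symm

variable (X) in
/-- A simplicial set that satisfies the Segal condition maps to the nerve of its category of
edges. -/
noncomputable def toNerve : X ⟶ nerve (Obj X) where
  app Δ := ↾fun x => chain x
  naturality Y Z f := by
    refine ConcreteCategory.hom_ext _ _ fun x => ?_
    have hv (i : Fin (Z.unop.len + 1)) : vtx (X.map f x) i = vtx x (f.unop.toOrderHom i) :=
      vtx_map f.unop x i
    exact Functor.hext (fun i => congrArg Obj.mk (hv i)) (fun i j g =>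
      Hom.heq (congrArg Obj.mk (hv i)) (congrArg Obj.mk (hv j)) (edge_map f.unop x i j (leOfHom g)))

theorem chain_injective {n : ℕ} : Function.Injective (chain (X := X) (n := n)) := fun x y h => by
  have hv (i : Fin (n + 1)) : (chain x).obj i = (chain y).obj i := Functor.congr_obj h i
  exact simplex_ext (fun i => congrArg Obj.pt (hv i)) (fun i => Hom.edge_eq (hv _) (hv _)
    (Functor.hcongr_hom h (homOfLE (Fin.castSucc_le_succ i))))

theorem chain_surjective {n : ℕ} : Function.Surjective (chain (X := X) (n := n)) := fun G => by
  have hm (i : Fin n) : i.castSucc ⟶ i.succ := homOfLE (Fin.castSucc_le_succ i)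
  obtain ⟨x, hv, he⟩ := exists_simplex (X := X) (fun i => (G.obj i).pt)
    (fun i => (G.map (hm i)).edge) (fun i => (G.map (hm i)).src) (fun i => (G.map (hm i)).tgt)
  have ho (i : Fin (n + 1)) : (chain x).obj i = G.obj i := congrArg Obj.mk (hv i)
  refine ⟨x, ComposableArrows.ext ho fun i hi => ?_⟩
  exact (conj_eqToHom_iff_heq _ _ (ho _) (ho _)).2 (Hom.heq (ho _) (ho _) (he ⟨i, hi⟩))

instance : IsIso (toNerve X) := by
  rw [NatTrans.isIso_iff_isIso_app]
  intro Δ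
  rw [isIso_iff_bijective]
  exact ⟨chain_injective, chain_surjective⟩

/-- A simplicial set that satisfies the Segal condition is the nerve of its category of edges. -/
noncomputable def nerveIso : X ≅ nerve (Obj X) := asIso (toNerve X)

end Segal


/-! ### The unary operadic category of a unary structure -/

namespace UnaryStructure

variable {C : Type u} [SmallCategory C] (S : UnaryStructure C)

/-- The local terminal object that an object maps to. -/
noncomputable def target (X : C) : C := (S.exists_term X).choose

theorem isTerm_target (X : C) : S.IsTerm (S.target X) := (S.exists_term X).choose_spec.1

/-- The map from an object to the local terminal object in its component. -/
noncomputable def toTarget (X : C) : X ⟶ S.target X := (S.exists_term X).choose_spec.2.some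

theorem target_eq_of_hom {X T : C} (hT : S.IsTerm T) (f : X ⟶ T) : S.target X = T :=
  S.term_uniq (S.isTerm_target X) hT (S.toTarget X) f

theorem target_eq_of_zigzag {X Y : C} (h : Zigzag X Y) : S.target X = S.target Y := by
  induction h with
  | refl => rfl
  | tail _ h ih =>
    refine ih.trans ?_
    rcases h with ⟨⟨f⟩⟩ | ⟨⟨f⟩⟩
    · exact S.target_eq_of_hom (S.isTerm_target _) (f ≫ S.toTarget _)
    · exact (S.target_eq_of_hom (S.isTerm_target _) (f ≫ S.toTarget _)).symm

/-- The data of an operadic category all of whose objects have cardinality `1`, determined by a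
unary structure. -/
noncomputable def operadicData : OperadicData C where
  term := Quotient.lift S.target fun _ _ h => S.target_eq_of_zigzag h
  term_mem := by
    rintro ⟨X⟩
    exact (Quotient.sound (Zigzag.of_hom (S.toTarget X))).symm
  τ := S.toTarget
  τ_uniq X _ := S.hom_uniq (S.isTerm_target X) _ _
  card :=
    { obj _ := FinOrdinal.one
      map _ := 𝟙 FinOrdinal.one }
  fibreFunctor X _ := S.fib X

theorem isTerm_iff (X : C) : S.IsTerm X ↔ ∃ c, X = S.operadicData.term c := by
  constructor
  · intro hX
    exact ⟨CategoryTheory.ConnectedComponents.mk X, (S.target_eq_of_hom hX (𝟙 X)).symm⟩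
  · rintro ⟨⟨Y⟩, rfl⟩
    exact S.isTerm_target Y

theorem isOperadic_operadicData : S.operadicData.IsOperadic where
  card_term _ := rfl
  fibre_id X _ := (S.isTerm_iff _).1 (S.isTerm_fib_id X)
  card_fibre _ _ := (FinOrdinal.fibre_eq_one rfl rfl _ _).symm
  card_fibreMap _ _ _ :=
    FinOrdinal.hom_heq (FinOrdinal.fibre_eq_one rfl rfl _ _).symm rfl
      (FinOrdinal.fibre_eq_one rfl rfl _ _) _ _
  fibre_τ X _ := S.fib_obj_term (S.isTerm_target X) _
  fibreMap_τ {Y X} f _ := S.fib_map_term (S.isTerm_target X)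
    (Over.homMk f : Over.mk (f ≫ S.toTarget X) ⟶ Over.mk (S.toTarget X))
  fibre_fibreMap g f _ _ := S.fib_obj_fib_map (Over.homMk g : Over.mk (g ≫ f) ⟶ Over.mk f)
  fibreMap_fibreMap h g f _ _ := by
    refine HEq.trans ?_ (S.fib_map_fib_map
      (Over.homMk h : Over.mk (h ≫ g ≫ f) ⟶ Over.mk (g ≫ f)) (Over.homMk g : _ ⟶ Over.mk f))
    rfl

/-- The unary operadic category determined by a unary structure. -/
noncomputable def toUnaryOpCat : UnaryOpCat.{u} :=
  ⟨{ carrier := C, str := S.operadicData, isOperadic := S.isOperadic_operadicData }, fun _ => rfl⟩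

/-- An equality of structures on the same category, so the nerves agree by `eqToIso`. -/
theorem unaryStructure_toUnaryOpCat :
    S.toUnaryOpCat.obj.unaryStructure S.toUnaryOpCat.property = S :=
  UnaryStructure.ext (funext fun X => propext (S.isTerm_iff X).symm) rfl

end UnaryStructure

theorem nonempty_unaryNerve_iso (K : SSet.{u}) (hK : isDecSegal K) :
    ∃ A : UnaryOpCat.{u}, Nonempty (unaryNerve.obj A ≅ K) := by
  have : (dec.obj K).IsStrictSegal := hK
  let e : dec.obj K ≅ nerve (Segal.Obj (dec.obj K)) := Segal.nerveIso
  let S := DecNerve.unaryStructure e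
  refine ⟨S.toUnaryOpCat, ⟨?_ ≪≫ (asIso (DecNerve.toOperadicNerve e)).symm⟩⟩
  exact eqToIso (congrArg operadicNerve S.unaryStructure_toUnaryOpCat)


/-! ### The Segal condition as a locality condition -/

namespace Segal

/-- A path of length `n + 1` is an edge followed by a path of length `n`; a simplicial set satisfies
the Segal condition if and only if each edge and `n`-simplex that are composable have a unique
concatenation. -/
theorem isStrictSegal_iff (X : SSet.{u}) :
    X.IsStrictSegal ↔ ∀ (n : ℕ) (s : X.obj (op (.mk n))) (a : X.obj (op (.mk 1))),
      X.map (SimplexCategory.const (.mk 0) (.mk n) 0).op s =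
        X.map (SimplexCategory.const (.mk 0) (.mk 1) 1).op a →
      ∃! x : X.obj (op (.mk (n + 1))), X.map (SimplexCategory.δ 0).op x = s ∧
        X.map (SimplexCategory.mkOfSucc 0).op x = a := by
  constructor
  · intro _ n s a h
    have hδ (x : X.obj (op (.mk (n + 1)))) (i : Fin (n + 1)) :
        vtx (X.map (SimplexCategory.δ 0).op x) i = vtx x i.succ := vtx_map _ _ _
    have hδ' (x : X.obj (op (.mk (n + 1)))) (i : Fin n) :
        edge (X.map (SimplexCategory.δ 0).op x) i.castSucc i.succ (Fin.castSucc_le_succ i) =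
          edge x i.succ.castSucc i.succ.succ (Fin.castSucc_le_succ _) := edge_map _ _ _ _ _
    have h0 (x : X.obj (op (.mk (n + 1)))) :
        vtx (X.map (SimplexCategory.mkOfSucc 0).op x) 0 = vtx x 0 := vtx_map _ _ _
    obtain ⟨x, hv, he⟩ := exists_simplex (X := X) (n := n + 1)
      (Fin.cons (vtx a 0) fun i => vtx s i)
      (Fin.cons a fun i => edge s i.castSucc i.succ (Fin.castSucc_le_succ i))
      (fun i => by
        cases i using Fin.cases with
        | zero => rfl
        | succ i => exact vtx_edge_zero _ _ _ _)
      (fun i => by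
        cases i using Fin.cases with
        | zero => exact h.symm
        | succ i => exact vtx_edge_one _ _ _ _)
    refine ⟨x, ⟨simplex_ext (fun i => ?_) (fun i => ?_), he 0⟩, ?_⟩
    · exact (hδ x i).trans (hv i.succ)
    · exact (hδ' x i).trans (he i.succ)
    · rintro y ⟨rfl, rfl⟩
      refine simplex_ext (fun i => ?_) (fun i => ?_)
      · cases i using Fin.cases with
        | zero => exact ((h0 y).symm.trans (hv 0).symm)
        | succ i => exact ((hδ y i).symm.trans (hv i.succ).symm)
      · cases i using Fin.cases with
        | zero => exact (he 0).symm
        | succ i => exact ((hδ' y i).symm.trans (he i.succ).symm)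
  · intro h
    have h' (n : ℕ) (a : X.obj (op (.mk 1))) (s : X.obj (op (.mk n)))
        (hs : X.δ 0 a = X.map (SimplexCategory.const (.mk 0) (.mk n) 0).op s) :=
      h n s a (hs.symm.trans (vtx_one_eq a).symm)
    exact (SSet.StrictSegal.ofCore fun n =>
      { concat a s hs := (h' n a s hs).choose
        map_mkOfSucc_zero_concat a s hs := (h' n a s hs).choose_spec.1.2
        δ₀_concat a s hs := (h' n a s hs).choose_spec.1.1
        injective {x y} hxy h0 := by
          refine (h n (X.δ 0 y) (X.map (SimplexCategory.mkOfSucc 0).op y) ?_).unique ⟨h0, hxy⟩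
            ⟨rfl, rfl⟩
          refine (map_map_of_eq X rfl y).trans (map_map_of_eq X ?_ y).symm
          ext i : 3
          rfl }).isStrictSegal

end Segal

/-! ### Orthogonality and reflectivity -/

section Local

variable {a b c d : SimplexCategory} {p : a ⟶ b} {q : a ⟶ c} {r : b ⟶ d} {s : c ⟶ d}

/-- The map from a pushout of standard simplices to a standard simplex that is determined by a
commutative square. -/
noncomputable def pushoutToStdSimplex (h : p ≫ r = q ≫ s) :
    Limits.pushout (SSet.stdSimplex.{u}.map p) (SSet.stdSimplex.map q) ⟶ SSet.stdSimplex.obj d :=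
  Limits.pushout.desc (SSet.stdSimplex.map r) (SSet.stdSimplex.map s)
    ((SSet.stdSimplex.map_comp p r).symm.trans
      ((congrArg SSet.stdSimplex.map h).trans (SSet.stdSimplex.map_comp q s)))

/-- By Yoneda, maps from the pushout to `K` are compatible pairs of simplices, and maps from the
standard simplex are their common fillers. -/
theorem bijective_pushoutToStdSimplex_comp_iff (h : p ≫ r = q ≫ s) (K : SSet.{u}) :
    Function.Bijective (fun g : SSet.stdSimplex.obj d ⟶ K => pushoutToStdSimplex h ≫ g) ↔
      ∀ (x : K.obj (op b)) (y : K.obj (op c)), K.map p.op x = K.map q.op y →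
        ∃! z : K.obj (op d), K.map r.op z = x ∧ K.map s.op z = y := by
  have hr (g : SSet.stdSimplex.obj d ⟶ K) : K.map r.op (SSet.yonedaEquiv g) =
      SSet.yonedaEquiv (Limits.pushout.inl _ _ ≫ pushoutToStdSimplex h ≫ g) := by
    rw [pushoutToStdSimplex, Limits.pushout.inl_desc_assoc, SSet.yonedaEquiv_naturality]
  have hs (g : SSet.stdSimplex.obj d ⟶ K) : K.map s.op (SSet.yonedaEquiv g) =
      SSet.yonedaEquiv (Limits.pushout.inr _ _ ≫ pushoutToStdSimplex h ≫ g) := by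
    rw [pushoutToStdSimplex, Limits.pushout.inr_desc_assoc, SSet.yonedaEquiv_naturality]
  constructor
  · intro hb x y hxy
    obtain ⟨f, rfl⟩ := SSet.yonedaEquiv.surjective x
    obtain ⟨g, rfl⟩ := SSet.yonedaEquiv.surjective y
    rw [SSet.yonedaEquiv_naturality, SSet.yonedaEquiv_naturality,
      EmbeddingLike.apply_eq_iff_eq] at hxy
    obtain ⟨k, hk⟩ := hb.2 (Limits.pushout.desc f g hxy)
    dsimp only at hk
    refine ⟨SSet.yonedaEquiv k, ⟨?_, ?_⟩, fun z hz => ?_⟩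
    · rw [hr, hk, Limits.pushout.inl_desc]
    · rw [hs, hk, Limits.pushout.inr_desc]
    · obtain ⟨l, rfl⟩ := SSet.yonedaEquiv.surjective z
      refine congrArg _ (hb.1 (Limits.pushout.hom_ext ?_ ?_))
      · rw [hr] at hz
        refine (SSet.yonedaEquiv.injective hz.1).trans ?_
        dsimp only
        rw [hk, Limits.pushout.inl_desc]
      · rw [hs] at hz
        refine (SSet.yonedaEquiv.injective hz.2).trans ?_
        dsimp only
        rw [hk, Limits.pushout.inr_desc]
  · intro hu
    have hw (g : SSet.stdSimplex.obj d ⟶ K) : K.map p.op (K.map r.op (SSet.yonedaEquiv g)) =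
        K.map q.op (K.map s.op (SSet.yonedaEquiv g)) :=
      (map_map_of_eq K h _).trans (map_map_of_eq K rfl _).symm
    refine ⟨fun f g hfg => ?_, fun f => ?_⟩
    · dsimp only at hfg
      refine SSet.yonedaEquiv.injective ((hu _ _ (hw g)).unique ⟨?_, ?_⟩ ⟨rfl, rfl⟩)
      · rw [hr, hr, hfg]
      · rw [hs, hs, hfg]
    · obtain ⟨z, ⟨hx, hy⟩, -⟩ := hu (SSet.yonedaEquiv (Limits.pushout.inl _ _ ≫ f))
        (SSet.yonedaEquiv (Limits.pushout.inr _ _ ≫ f)) (by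
          rw [SSet.yonedaEquiv_naturality, SSet.yonedaEquiv_naturality,
            Limits.pushout.condition_assoc])
      obtain ⟨g, rfl⟩ := SSet.yonedaEquiv.surjective z
      rw [hr] at hx
      rw [hs] at hy
      exact ⟨g, Limits.pushout.hom_ext (SSet.yonedaEquiv.injective hx)
        (SSet.yonedaEquiv.injective hy)⟩

end Local

/-- Written as locality with respect to maps, the Segal condition is visibly invariant under
isomorphism. -/
theorem isStrictSegal_of_iso {X Y : SSet.{u}} (i : X ≅ Y) (hX : X.IsStrictSegal) :
    Y.IsStrictSegal := by
  rw [Segal.isStrictSegal_iff] at hX ⊢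
  intro n
  have h : SimplexCategory.const (.mk 0) (.mk n) 0 ≫ SimplexCategory.δ (0 : Fin (n + 2)) =
      SimplexCategory.const (.mk 0) (.mk 1) 1 ≫ SimplexCategory.mkOfSucc (0 : Fin (n + 1)) := by
    ext i : 3
    rfl
  have hX' := (MorphismProperty.isLocal_single_iff_bijective _ _).2
    ((bijective_pushoutToStdSimplex_comp_iff h X).2 (hX n))
  exact (bijective_pushoutToStdSimplex_comp_iff h Y).1
    ((MorphismProperty.isLocal_single_iff_bijective _ _).1 (ObjectProperty.prop_of_iso _ i hX'))

/-- Since D(K) is `K` precomposed with T, its Segal condition is tested on `K` by the T-image of the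
square gluing an edge to an n-simplex. -/
theorem decSegal_square (n : ℕ) :
    addTop.map (SimplexCategory.const (.mk 0) (.mk n) 0) ≫
        addTop.map (SimplexCategory.δ (0 : Fin (n + 2))) =
      addTop.map (SimplexCategory.const (.mk 0) (.mk 1) 1) ≫
        addTop.map (SimplexCategory.mkOfSucc (0 : Fin (n + 1))) := by
  rw [← Functor.map_comp, ← Functor.map_comp]
  congr 1

/-- The maps of simplicial sets that detect the Segal condition on the décalage. -/
def decSegalMaps : MorphismProperty SSet.{u} :=
  MorphismProperty.ofHoms fun n => pushoutToStdSimplex (decSegal_square n)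

theorem isDecSegal_eq_isLocal : isDecSegal.{u} = decSegalMaps.isLocal := by
  ext K
  refine (Segal.isStrictSegal_iff (dec.obj K)).trans ⟨fun h => ?_, fun h n => ?_⟩
  · rintro _ _ _ ⟨n⟩
    exact (bijective_pushoutToStdSimplex_comp_iff (decSegal_square n) K).2 (h n)
  · exact (bijective_pushoutToStdSimplex_comp_iff (decSegal_square n) K).1 (h _ ⟨n⟩)

theorem nonempty_reflective : Nonempty (Reflective isDecSegal.{u}.ι) := by
  rw [isDecSegal_eq_isLocal]
  have := Cardinal.fact_isRegular_aleph0.{u}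
  have : MorphismProperty.IsSmall.{u} decSegalMaps.{u} :=
    MorphismProperty.isSmall_ofHoms.{u} _
  have : decSegalMaps.{u}.isLocal.ι.IsRightAdjoint := by
    refine decSegalMaps.isRightAdjoint_ι_isLocal Cardinal.aleph0.{u} ?_
    rintro _ _ _ ⟨n⟩
    refine ⟨?_, inferInstance⟩
    -- The corners of the span are standard simplices, hence finitely presentable, and so is their
    -- finite colimit.
    have (k : Limits.WalkingSpan) : IsCardinalPresentable
        ((Limits.span (SSet.stdSimplex.{u}.map
          (addTop.map (SimplexCategory.const (.mk 0) (.mk n) 0)))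
          (SSet.stdSimplex.map (addTop.map (SimplexCategory.const (.mk 0) (.mk 1) 1)))).obj k)
        Cardinal.aleph0.{u} := by
      rcases k with _ | _ | _
      all_goals
        dsimp
        infer_instance
    exact isCardinalPresentable_of_isColimit' _ (Limits.colimit.isColimit _) _
      (hasCardinalLT_of_finite _ _ le_rfl)
  exact ⟨{ L := decSegalMaps.isLocal.ι.leftAdjoint
           adj := Adjunction.ofIsRightAdjoint _ }⟩

/-! ### The equivalence -/

/-- The nerve of a unary operadic category has a décalage that satisfies the Segal condition. -/
theorem isDecSegal_unaryNerve (A : UnaryOpCat.{u}) : isDecSegal (unaryNerve.obj A) :=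
  isStrictSegal_of_iso (unaryNerveCompDec.app A).symm (Nerve.isStrictSegal A.obj.carrier)

/-- The nerve functor from unary operadic categories to the simplicial sets whose décalage
satisfies the Segal condition. -/
def toDecSegal : UnaryOpCat.{u} ⥤ isDecSegal.{u}.FullSubcategory :=
  isDecSegal.lift unaryNerve isDecSegal_unaryNerve

instance : toDecSegal.{u}.Full := inferInstanceAs (isDecSegal.lift unaryNerve _).Full

instance : toDecSegal.{u}.Faithful := inferInstanceAs (isDecSegal.lift unaryNerve _).Faithful

instance : toDecSegal.{u}.EssSurj where
  mem_essImage K := by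
    obtain ⟨A, ⟨i⟩⟩ := nonempty_unaryNerve_iso K.obj K.property
    exact ⟨A, ⟨isDecSegal.isoMk i⟩⟩

instance : toDecSegal.{u}.IsEquivalence where

end Operadic

/-- The category of unary operadic categories is identified with the full subcategory of those
simplicial sets `C` whose décalage satisfies the Segal condition, in such a way that the décalage
of the simplicial set assigned to a unary operadic category is its nerve; and this full
subcategory is reflective. -/
theorem corollary1 :
    (∃ E : Operadic.UnaryOpCat.{u} ≌ Operadic.isDecSegal.{u}.FullSubcategory,
      Nonempty (E.functor ⋙ Operadic.isDecSegal.{u}.ι ⋙ Operadic.dec.{u} ≅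
        Operadic.OpCat.isUnary.{u}.ι ⋙ Operadic.OpCat.forget.{u} ⋙ nerveFunctor.{u, u})) ∧
    Nonempty (Reflective Operadic.isDecSegal.{u}.ι) :=
  ⟨⟨Operadic.toDecSegal.asEquivalence, ⟨Operadic.unaryNerveCompDec⟩⟩, Operadic.nonempty_reflective⟩
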